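/- Let $\{p_j\}_{j\ge 0}$ be a probability distribution with $p_0>0$, $p_1=0$ and $\sum_{j\ge 0} jp_j=1$, and consider the Galton--Watson branching process, started by a single progenitor, with this offspring distribution, where the children of each individual are ordered. Then with probability $1$ the process eventually stops, so that a finite rooted ordered terminal tree $T_t$ is a.s. well defined. Let $A_n=\{T_t\text{ has }n\text{ leaves}\}$ and $P(\eta)=\sum_{j\ge 0}p_j\eta^j$. There is exactly one formal power series $\Phi$ with $\Phi(0)=0$ and $\Phi(y)=P(\Phi(y))+p_0(y-1)$; its series converges, and this equation holds with $|\Phi(y)|\le 1$, for all complex $y$ with $|y|\le 1$. **(1)** For every $n\ge 0$, $\mathbb P(A_n)=[y^n]\Phi(y)$. **(2)** On the event $A_n$ let $T_n$ be the tree $T_t$ with its leaves labelled uniformly at random by the elements of $[n]$. Let $S\subseteq[n]$, $|S|=a$, and let $\mathcal T$ be a finite rooted ordered tree with leaf-set $S$ in which every non-leaf vertex has at least two children. The LCA subtree of $S$ in $T_n$ consists of the paths from the lowest common ancestor of $S$ down to the leaves in $S$. We say that $S$ induces $\mathcal T$ in $T_n$ if suppressing the non-root vertices of degree $2$ of the LCA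 subtree turns it into $\mathcal T$ (as a rooted ordered tree with labelled leaves), and every vertex that is not suppressed has the same out-degree in $T_n$ as in $\mathcal T$. Let $A_n(\mathcal T)$ be the event that $A_n$ holds and $S$ induces $\mathcal T$ in $T_n$. Then $$\mathbb P(A_n(\mathcal T))=\frac{\mathbb P(\mathcal T)\,(n-a)!}{p_0\,n!}\,[y^{n-a}]\,(1-\Phi_1(y))^{-e(\mathcal T)}\,\Phi'(y),$$ where $\Phi_1(y)=\sum_{j>1}jp_j\Phi(y)^{j-1}$, $\mathbb P(\mathcal T)=\prod_{v\in V(\mathcal T)}p_{d(v,\mathcal T)}$ with $d(v,\mathcal T)$ the out-degree of $v$ in $\mathcal T$, and $V(\mathcal T)$ and $e(\mathcal T)$ are the vertex set and the number of edges of $\mathcal T$. If $\mathbb P(A_n)>0$, then also $\mathbb P(A_n(\mathcal T)\mid A_n)=\mathbb P(A_n(\mathcal T))/\mathbb P(A_n)$. -/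

import Mathlib

open MeasureTheory ProbabilityTheory
open scoped Nat

noncomputable section

/-- A finite rooted plane (ordered) tree, in Ulam-Harris coding: a vertex is the word recording
the birth ranks (starting from `0`) along the path from the root `[]` to it, so that the children
of `u` are `u ++ [0], u ++ [1], …`, in this order. -/
@[ext]
structure PlaneTree where
  /-- The vertex set. -/
  verts : Finset (List ℕ)
  root_mem : [] ∈ verts
  parent_mem : ∀ u i, u ++ [i] ∈ verts → u ∈ verts
  sibling_mem : ∀ u i, u ++ [i + 1] ∈ verts → u ++ [i] ∈ verts

namespace PlaneTree

/-- The out-degree (number of children) of `u` in `t`. -/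
def outDeg (t : PlaneTree) (u : List ℕ) : ℕ := {i : ℕ | u ++ [i] ∈ t.verts}.ncard

/-- The leaves of `t`: the vertices of out-degree zero. -/
def leaves (t : PlaneTree) : Finset (List ℕ) := t.verts.filter fun u => t.outDeg u = 0

/-- The number of (parent, child) edges of `t`. -/
def numEdges (t : PlaneTree) : ℕ :=
  {e : List ℕ × List ℕ | e.1 ∈ t.verts ∧ e.2 ∈ t.verts ∧ ∃ i, e.2 = e.1 ++ [i]}.ncard

/-- The product over the vertices `v` of `t` of `p (out-degree of v)`. -/
def weight (p : ℕ → ℝ) (t : PlaneTree) : ℝ := ∏ v ∈ t.verts, p (t.outDeg v)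

end PlaneTree

/-- A finite plane tree whose leaves are labelled bijectively by the elements of `L`;
`pos s` is the leaf that carries the label `s`. -/
@[ext]
structure LabelledTree (L : Type*) extends PlaneTree where
  /-- The leaf with a given label. -/
  pos : L → List ℕ
  pos_injective : Function.Injective pos
  range_pos : Set.range pos = (toPlaneTree.leaves : Set (List ℕ))

namespace LabelledTree

variable {L : Type*}

/-- `v` is the lowest common ancestor in `T` of the leaves with labels in `S`. -/
def IsLCA (T : LabelledTree L) (S : Finset L) (v : List ℕ) : Prop :=
  v ∈ T.verts ∧ (∀ s ∈ S, v <+: T.pos s) ∧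
    ∀ w ∈ T.verts, (∀ s ∈ S, w <+: T.pos s) → w <+: v

/-- The vertex set of the LCA subtree of `S` in `T`: the vertices on the paths that lead from the
lowest common ancestor of `S` down to the leaves with labels in `S`. -/
def lcaSubtree (T : LabelledTree L) (S : Finset L) : Set (List ℕ) :=
  {u | ∃ v, T.IsLCA S v ∧ v <+: u ∧ ∃ s ∈ S, u <+: T.pos s}

/-- The vertices of the LCA subtree that are not suppressed: its root, and the vertices whose
number of children inside the LCA subtree is different from one. -/
def retained (T : LabelledTree L) (S : Finset L) : Set (List ℕ) :=
  {u | u ∈ T.lcaSubtree S ∧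
    (T.IsLCA S u ∨ {i : ℕ | u ++ [i] ∈ T.lcaSubtree S}.ncard ≠ 1)}

/-- `S` induces the tree `τ` (with leaves labelled by `S`) in `T`: after suppression of the
non-root vertices of degree two, the LCA subtree of `S` in `T` is isomorphic to `τ` as a rooted
ordered leaf-labelled tree, and every retained vertex has in `T` the same out-degree as the
corresponding vertex of `τ`. An isomorphism preserves the ancestor relation (prefix), the
left-to-right order (lexicographic order of words) and the leaf labels. -/
def Induces (T : LabelledTree L) (S : Finset L) (τ : LabelledTree S) : Prop :=
  ∃ f : List ℕ → List ℕ,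
    Set.BijOn f (τ.verts : Set (List ℕ)) (T.retained S) ∧
    (∀ u ∈ τ.verts, ∀ v ∈ τ.verts, (u <+: v ↔ f u <+: f v)) ∧
    (∀ u ∈ τ.verts, ∀ v ∈ τ.verts, (u < v ↔ f u < f v)) ∧
    (∀ s : S, f (τ.pos s) = T.pos s) ∧
    (∀ u ∈ τ.verts, T.outDeg (f u) = τ.outDeg u)

end LabelledTree

/-- The (possibly infinite) genealogical tree in which the potential individual `v` has `c v`
children: `u` is born iff at every step of the path from the root to `u` the birth rank is
smaller than the number of children of the parent. -/
def genealogy (c : List ℕ → ℕ) : Set (List ℕ) :=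
  {u | ∀ v i, v ++ [i] <+: u → i < c v}

/-- The process with family sizes `c` stops, and `t` is its terminal tree. -/
def IsTerminalTree (c : List ℕ → ℕ) (t : PlaneTree) : Prop :=
  (t.verts : Set (List ℕ)) = genealogy c

/-- `ξ` is a Galton-Watson process with offspring distribution `p`: the numbers of children
`ξ u` of the potential individuals `u` are independent and have distribution `p`. -/
structure IsGaltonWatson {Ω : Type*} [MeasurableSpace Ω] (μ : Measure Ω) (p : ℕ → ℝ)
    (ξ : List ℕ → Ω → ℕ) : Prop where
  measurable : ∀ u, Measurable (ξ u)
  indep : iIndepFun ξ μ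
  law : ∀ u j, μ.real {ω | ξ u ω = j} = p j

/-- The event `A_n`: there is a (finite) terminal tree and it has `n` leaves. -/
def leafEvent {Ω : Type*} (ξ : List ℕ → Ω → ℕ) (n : ℕ) : Set Ω :=
  {ω | ∃ t : PlaneTree, IsTerminalTree (fun u => ξ u ω) t ∧ t.leaves.card = n}

/-- On the event `A_n`, the random tree `T` is the terminal tree with its leaves labelled
uniformly at random by the `n` elements of `Fin n`: given the terminal tree, each of the `n!`
labellings of its leaves has the same probability. -/
structure IsUniformLabelling {Ω : Type*} [MeasurableSpace Ω] (μ : Measure Ω)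
    (ξ : List ℕ → Ω → ℕ) (n : ℕ) (T : Ω → LabelledTree (Fin n)) : Prop where
  terminal : ∀ ω ∈ leafEvent ξ n, IsTerminalTree (fun u => ξ u ω) (T ω).toPlaneTree
  measurable : ∀ τ : LabelledTree (Fin n),
    MeasurableSet {ω | ω ∈ leafEvent ξ n ∧ T ω = τ}
  uniform : ∀ τ : LabelledTree (Fin n),
    μ.real {ω | ω ∈ leafEvent ξ n ∧ T ω = τ} =
      μ.real {ω | IsTerminalTree (fun u => ξ u ω) τ.toPlaneTree} / (n ! : ℝ)

/-- The event `A_n(τ)`: `A_n` holds and `S` induces `τ` in `T`. -/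
def inducedEvent {Ω : Type*} (ξ : List ℕ → Ω → ℕ) (n : ℕ) (T : Ω → LabelledTree (Fin n))
    (S : Finset (Fin n)) (τ : LabelledTree S) : Set Ω :=
  {ω | ω ∈ leafEvent ξ n ∧ (T ω).Induces S τ}

/-- `Φ` is a formal power series without constant term (so that it may be substituted into
power series) and `Φ(y) = P(Φ(y)) + p_0 (y - 1)`, where `P(η) = ∑ p_j η^j`. -/
def IsLeafSeries (p : ℕ → ℝ) (Φ : PowerSeries ℝ) : Prop :=
  PowerSeries.constantCoeff Φ = 0 ∧
    Φ = (PowerSeries.mk p).subst Φ + PowerSeries.C (p 0) * (PowerSeries.X - 1)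

/-- `Φ₁(y) = ∑_{j > 1} j p_j Φ(y)^(j-1)`; the summation index below is `i = j - 1`. -/
def leafSeriesOne (p : ℕ → ℝ) (Φ : PowerSeries ℝ) : PowerSeries ℝ :=
  (PowerSeries.mk fun i => if 1 ≤ i then ((i : ℝ) + 1) * p (i + 1) else 0).subst Φ

end

/-! A drawing of `τ` into `t` sends vertices to vertices of the same out-degree and the `i`-th child
of `u` to a descendant of the `i`-th child of the image of `u` (`IsEmb`). Since `τ` has no vertex of
out-degree one, `S` induces `τ` in `T` exactly when some drawing of `τ` into `T` respects the labels
(`induces_iff`), and such a drawing is unique, a vertex being the meet of the leaves above it. So a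
tree `t` with `n` leaves has (number of drawings) · (n - a)! favourable labellings out of n!. As the
terminal tree equals `t` with probability `weight p t`, the probability sought is (n - a)!/n! times
the n-th coefficient of E_τ, the generating function by leaves of the trees with a distinguished
drawing of `τ` (`measure_inducedEvent`).

Cutting a tree at its root gives the functional equation of Φ. Cutting a tree with a drawing gives
one for E_τ: if the root of `τ` has d branches τ_i, then either the root goes to the root and the
drawing splits into drawings of the τ_i, or the whole drawing lies in one branch of the tree. Thus
E_τ = p_d ∏ E_{τ_i} + Φ₁ E_τ, with y for the product if d = 0 (`embGF_node`), and induction on `τ`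
yields E_τ = P(τ) y^a (1 - Φ₁)^{-|V(τ)|} (`realPart_embGF`). Differentiating the functional equation
gives Φ' = p_0 (1 - Φ₁)^{-1}, and |V(τ)| = e(τ) + 1.

The counting takes values in [0, ∞], where sums need no convergence argument, and passes to real
series because all coefficients are finite. Extinction follows from q = P(q) for the extinction
probability q and Bernoulli's inequality. Convergence in the disc holds because the coefficients of
Φ are probabilities of disjoint events. -/

open scoped ENNReal

/-! ### Prefixes and lexicographic order of words -/

section Words

variable {a b u v w x : List ℕ} {i j : ℕ}

theorem List.IsPrefix.antisymm' (h : u <+: v) (h' : v <+: u) : u = v :=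
  h.eq_of_length (le_antisymm h.length_le h'.length_le)

theorem List.IsPrefix.eq_or_snoc (h : u <+: v) : u = v ∨ ∃ i, u ++ [i] <+: v := by
  obtain ⟨t, rfl⟩ := h
  cases t with
  | nil => simp
  | cons i t => exact Or.inr ⟨i, t, by simp⟩

theorem List.IsPrefix.of_snoc (h : u ++ [i] <+: v) : u <+: v :=
  (List.prefix_append u [i]).trans h

theorem snoc_prefix_inj (h : u ++ [i] <+: v) (h' : u ++ [j] <+: v) : i = j := by
  obtain ⟨t, rfl⟩ := h
  simpa [List.append_assoc, eq_comm] using h'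

theorem not_snoc_prefix_self : ¬ u ++ [i] <+: u := fun h => by
  have := h.length_le
  simp at this

/-- Two words lie below different children of `x`: every common prefix of theirs is one of `x`. -/
theorem prefix_of_branch (hij : i ≠ j) (ha : x ++ [i] <+: a) (hb : x ++ [j] <+: b)
    (hwa : w <+: a) (hwb : w <+: b) : w <+: x := by
  rcases List.prefix_or_prefix_of_prefix hwa ha.of_snoc with h | h
  · exact h
  · rcases h.eq_or_snoc with rfl | ⟨k, hk⟩
    · exact List.prefix_rfl
    · exact absurd ((snoc_prefix_inj ha (hk.trans hwa)).trans
        (snoc_prefix_inj hb (hk.trans hwb)).symm) hij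

theorem prefix_or_branch (u v : List ℕ) :
    u <+: v ∨ v <+: u ∨ ∃ x i j, i ≠ j ∧ x ++ [i] <+: u ∧ x ++ [j] <+: v := by
  induction u generalizing v with
  | nil => simp
  | cons k u ih =>
    cases v with
    | nil => simp
    | cons l v =>
      by_cases hkl : k = l
      · subst hkl
        rcases ih v with h | h | ⟨x, i, j, h, h1, h2⟩
        · simp [h]
        · simp [h]
        · exact Or.inr (Or.inr ⟨k :: x, i, j, h, by simpa using h1, by simpa using h2⟩)
      · exact Or.inr (Or.inr ⟨[], k, l, hkl, by simp, by simp⟩)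

theorem lt_iff_of_branch (hij : i ≠ j) (ha : x ++ [i] <+: a) (hb : x ++ [j] <+: b) :
    a < b ↔ i < j := by
  obtain ⟨s, rfl⟩ := ha
  obtain ⟨t, rfl⟩ := hb
  induction x with
  | nil => simp [List.cons_lt_cons_iff, hij]
  | cons k x ih => simpa [List.cons_lt_cons_iff] using ih

theorem lt_of_prefix_of_ne (h : a <+: b) (hne : a ≠ b) : a < b := by
  obtain ⟨t, rfl⟩ := h
  cases t with
  | nil => simp at hne
  | cons k t =>
    clear hne
    induction a with
    | nil => simp
    | cons k x ih => simpa [List.cons_lt_cons_iff] using ih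

end Words

/-! ### Plane trees and their decomposition at the root -/

namespace PlaneTree

variable {t : PlaneTree} {u v : List ℕ} {i : ℕ}

theorem mem_of_prefix (h : u <+: v) (hv : v ∈ t.verts) : u ∈ t.verts := by
  obtain ⟨s, rfl⟩ := h
  induction s using List.reverseRecOn with
  | nil => simpa using hv
  | append_singleton s i ih => exact ih (t.parent_mem _ i (by simpa using hv))

theorem snoc_mem_of_le {j : ℕ} (hij : i ≤ j) (h : u ++ [j] ∈ t.verts) : u ++ [i] ∈ t.verts := by
  induction j, hij using Nat.le_induction with
  | base => exact h
  | succ j _ ih => exact ih (t.sibling_mem _ _ h)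

theorem finite_children (t : PlaneTree) (u : List ℕ) : {i | u ++ [i] ∈ t.verts}.Finite :=
  (t.verts.finite_toSet.preimage (f := fun i => u ++ [i]) (by intro a _ b _ h; simpa using h))

theorem ncard_lt_eq (n : ℕ) : {i : ℕ | i < n}.ncard = n := by
  have h : {i : ℕ | i < n} = (Finset.range n : Set ℕ) := by ext; simp
  rw [h, Set.ncard_coe_finset, Finset.card_range]

/-- The birth ranks of the children form a finite set that `sibling_mem` closes downwards, hence an
initial segment; it ends at the first missing rank. -/
theorem snoc_mem_iff : u ++ [i] ∈ t.verts ↔ i < t.outDeg u := by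
  suffices h : ∃ n, {i | u ++ [i] ∈ t.verts} = {i | i < n} by
    obtain ⟨n, hn⟩ := h
    rw [outDeg, hn, ncard_lt_eq]
    exact Set.ext_iff.1 hn i
  obtain ⟨n, hn⟩ := (t.finite_children u).bddAbove
  classical
  have hex : ∃ m, u ++ [m] ∉ t.verts := ⟨n + 1, fun h => by have := hn h; omega⟩
  refine ⟨Nat.find hex, Set.ext fun i => ⟨fun h => ?_, fun h => not_not.1 (Nat.find_min hex h)⟩⟩
  by_contra hlt
  exact Nat.find_spec hex (snoc_mem_of_le (not_lt.1 hlt) h)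

theorem outDeg_eq_of_forall {n : ℕ} (h : ∀ i, u ++ [i] ∈ t.verts ↔ i < n) : t.outDeg u = n := by
  simp_rw [outDeg, h, ncard_lt_eq]

theorem mem_leaves : u ∈ t.leaves ↔ u ∈ t.verts ∧ t.outDeg u = 0 := by simp [leaves]

theorem exists_leaf (hu : u ∈ t.verts) : ∃ l ∈ t.leaves, u <+: l := by
  obtain ⟨m, hm, hmax⟩ := Finset.exists_max_image (t.verts.filter (u <+: ·)) List.length
    ⟨u, by simp [hu]⟩
  rw [Finset.mem_filter] at hm
  refine ⟨m, mem_leaves.2 ⟨hm.1, Nat.eq_zero_of_not_pos fun h => ?_⟩, hm.2⟩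
  have := hmax (m ++ [0]) (by simp [snoc_mem_iff.2 h, hm.2.trans (List.prefix_append m [0])])
  simp at this

theorem ext_verts {s t : PlaneTree} (h : ∀ u, u ∈ s.verts ↔ u ∈ t.verts) : s = t :=
  PlaneTree.ext (Finset.ext h)

/-- The tree whose root has `d` children, with the trees `ts i` growing from them. -/
def node (d : ℕ) (ts : Fin d → PlaneTree) : PlaneTree where
  verts := insert [] (Finset.univ.biUnion fun i : Fin d =>
    (ts i).verts.map ⟨List.cons (i : ℕ), List.cons_injective⟩)
  root_mem := by simp
  parent_mem := by
    rintro (_ | ⟨k, u⟩) i h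
    · simp
    · simp only [List.cons_append, Finset.mem_insert, Finset.mem_biUnion, Finset.mem_univ,
        Finset.mem_map, Function.Embedding.coeFn_mk, true_and, reduceCtorEq, false_or,
        List.cons.injEq] at h ⊢
      obtain ⟨j, a, ha, hj, rfl⟩ := h
      exact ⟨j, u, (ts j).parent_mem _ _ ha, hj, rfl⟩
  sibling_mem := by
    rintro (_ | ⟨k, u⟩) i h
    · simp only [List.nil_append, Finset.mem_insert, Finset.mem_biUnion, Finset.mem_univ,
        Finset.mem_map, Function.Embedding.coeFn_mk, true_and, reduceCtorEq, false_or,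
        List.cons.injEq] at h ⊢
      obtain ⟨j, a, ha, hj, rfl⟩ := h
      exact ⟨⟨i, by omega⟩, [], root_mem _, rfl, rfl⟩
    · simp only [List.cons_append, Finset.mem_insert, Finset.mem_biUnion, Finset.mem_univ,
        Finset.mem_map, Function.Embedding.coeFn_mk, true_and, reduceCtorEq, false_or,
        List.cons.injEq] at h ⊢
      obtain ⟨j, a, ha, hj, rfl⟩ := h
      exact ⟨j, _, (ts j).sibling_mem _ _ ha, hj, rfl⟩

variable {d : ℕ} {ts : Fin d → PlaneTree}

theorem cons_mem_node {k : ℕ} :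
    k :: u ∈ (node d ts).verts ↔ ∃ h : k < d, u ∈ (ts ⟨k, h⟩).verts := by
  simp only [node, Finset.mem_insert, Finset.mem_biUnion, Finset.mem_univ, Finset.mem_map,
    Function.Embedding.coeFn_mk, true_and, reduceCtorEq, false_or, List.cons.injEq]
  constructor
  · rintro ⟨j, a, ha, rfl, rfl⟩
    exact ⟨j.2, ha⟩
  · rintro ⟨h, hu⟩
    exact ⟨⟨k, h⟩, u, hu, rfl, rfl⟩

theorem cons_mem_node_fin {k : Fin d} :
    (k : ℕ) :: u ∈ (node d ts).verts ↔ u ∈ (ts k).verts := by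
  simp [cons_mem_node]

@[simp]
theorem outDeg_node_nil : (node d ts).outDeg [] = d :=
  outDeg_eq_of_forall fun i => by simp [cons_mem_node, root_mem]

@[simp]
theorem outDeg_node_cons (k : Fin d) (u : List ℕ) :
    (node d ts).outDeg (k :: u) = (ts k).outDeg u :=
  outDeg_eq_of_forall fun i => by
    rw [List.cons_append, cons_mem_node_fin, snoc_mem_iff]

theorem prod_node {M : Type*} [CommMonoid M] (g : List ℕ → M) :
    ∏ v ∈ (node d ts).verts, g v = g [] * ∏ i, ∏ v ∈ (ts i).verts, g (i :: v) := by
  rw [node, Finset.prod_insert (by simp), Finset.prod_biUnion]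
  · simp
  · intro i _ j _ hij
    rw [Function.onFun, Finset.disjoint_left]
    rintro a ha hb
    simp only [Finset.mem_map, Function.Embedding.coeFn_mk] at ha hb
    obtain ⟨x, -, rfl⟩ := ha
    obtain ⟨y, -, h⟩ := hb
    simp only [List.cons.injEq] at h
    exact hij (Fin.ext h.1.symm)

theorem sum_node {M : Type*} [AddCommMonoid M] (g : List ℕ → M) :
    ∑ v ∈ (node d ts).verts, g v = g [] + ∑ i, ∑ v ∈ (ts i).verts, g (i :: v) :=
  prod_node (M := Multiplicative M) g

theorem card_verts_node : (node d ts).verts.card = 1 + ∑ i, (ts i).verts.card := by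
  simp_rw [Finset.card_eq_sum_ones]
  exact sum_node fun _ => 1

theorem card_leaves_eq (t : PlaneTree) :
    t.leaves.card = ∑ v ∈ t.verts, if t.outDeg v = 0 then 1 else 0 := by
  rw [leaves, Finset.card_filter]

theorem card_leaves_node :
    (node d ts).leaves.card = (if d = 0 then 1 else 0) + ∑ i, (ts i).leaves.card := by
  simp_rw [card_leaves_eq, sum_node, outDeg_node_cons, outDeg_node_nil]

theorem weight_node (p : ℕ → ℝ) : (node d ts).weight p = p d * ∏ i, (ts i).weight p := by
  simp [weight, prod_node]

theorem card_leaves_pos (t : PlaneTree) : 0 < t.leaves.card := by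
  obtain ⟨l, hl, -⟩ := t.exists_leaf t.root_mem
  exact Finset.card_pos.2 ⟨l, hl⟩

/-- Each vertex other than the root is the lower end of exactly one edge. This later trades the
exponent |V| for e + 1. -/
theorem card_verts_eq (t : PlaneTree) : t.verts.card = t.numEdges + 1 := by
  have h : {e : List ℕ × List ℕ | e.1 ∈ t.verts ∧ e.2 ∈ t.verts ∧ ∃ i, e.2 = e.1 ++ [i]}
      = (fun v => (v.dropLast, v)) '' ((t.verts.erase [] : Finset (List ℕ)) : Set (List ℕ)) := by
    ext ⟨u, v⟩
    simp only [Set.mem_ofPred_eq, Finset.coe_erase, Set.mem_image, Set.mem_sdiff, Finset.mem_coe,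
      Set.mem_singleton_iff, Prod.mk.injEq]
    constructor
    · rintro ⟨-, hv, i, rfl⟩
      exact ⟨_, ⟨hv, by simp⟩, by simp, rfl⟩
    · rintro ⟨v, ⟨hv, hne⟩, rfl, rfl⟩
      exact ⟨mem_of_prefix (List.dropLast_prefix v) hv, hv, v.getLast hne,
        (List.dropLast_append_getLast hne).symm⟩
  rw [numEdges, h, Set.ncard_image_of_injective _ (fun a b h => congrArg Prod.snd h),
    Set.ncard_coe_finset, Finset.card_erase_add_one t.root_mem]

theorem node_injective :
    Function.Injective fun x : (Σ d, Fin d → PlaneTree) => node x.1 x.2 := by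
  rintro ⟨d, ts⟩ ⟨e, ss⟩ h
  obtain rfl : d = e := by simpa using congrArg (fun t => t.outDeg []) h
  congr
  funext k
  refine ext_verts fun u => ?_
  rw [← cons_mem_node_fin (ts := ts), ← cons_mem_node_fin (ts := ss)]
  exact iff_of_eq (congrArg (fun t => (k : ℕ) :: u ∈ t.verts) h)

theorem exists_eq_node (t : PlaneTree) : ∃ d ts, t = node d ts := by
  have hk (k : Fin (t.outDeg [])) : [(k : ℕ)] ∈ t.verts := by
    simpa using snoc_mem_iff.2 k.2
  refine ⟨t.outDeg [], fun k =>
    { verts := t.verts.preimage (List.cons (k : ℕ)) List.cons_injective.injOn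
      root_mem := by simpa using hk k
      parent_mem := fun u i h => by
        simp only [Finset.mem_preimage] at h ⊢
        exact t.parent_mem (_ :: u) i h
      sibling_mem := fun u i h => by
        simp only [Finset.mem_preimage] at h ⊢
        exact t.sibling_mem (_ :: u) i h }, ?_⟩
  refine ext_verts ?_
  rintro (_ | ⟨k, u⟩)
  · simp [root_mem]
  · rw [cons_mem_node]
    simp only [Finset.mem_preimage, exists_prop, iff_and_self]
    intro h
    exact snoc_mem_iff.1 (mem_of_prefix (u := [] ++ [k]) (by simp) h)

/-- A plane tree is the sequence of the subtrees that grow from the children of the root. -/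
noncomputable def nodeEquiv : (Σ d, Fin d → PlaneTree) ≃ PlaneTree :=
  Equiv.ofBijective (fun x => node x.1 x.2) ⟨node_injective, fun t => by
    obtain ⟨d, ts, h⟩ := t.exists_eq_node
    exact ⟨⟨d, ts⟩, h.symm⟩⟩

theorem nodeEquiv_mk : nodeEquiv ⟨d, ts⟩ = node d ts := rfl

theorem node_induction {motive : PlaneTree → Prop}
    (h : ∀ d ts, (∀ i, motive (ts i)) → motive (node d ts)) (t : PlaneTree) : motive t := by
  induction hn : t.verts.card using Nat.strong_induction_on generalizing t with
  | _ n ih =>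
    obtain ⟨d, ts, rfl⟩ := t.exists_eq_node
    refine h d ts fun i => ih _ ?_ _ rfl
    rw [← hn, card_verts_node]
    have := Finset.single_le_sum (f := fun i => (ts i).verts.card) (fun _ _ => Nat.zero_le _)
      (Finset.mem_univ i)
    omega

instance : Countable PlaneTree :=
  Function.Injective.countable (f := PlaneTree.verts) fun _ _ h => PlaneTree.ext h

end PlaneTree

/-! ### Drawings of one plane tree into another -/

namespace PlaneTree

/-- `f` draws `τ` into `t`: vertices go to vertices of the same out-degree, and the `i`-th child
of `u` goes to a descendant of the `i`-th child of the image of `u`. -/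
structure IsEmb (τ t : PlaneTree) (f : List ℕ → List ℕ) : Prop where
  mem : ∀ u ∈ τ.verts, f u ∈ t.verts
  outDeg_eq : ∀ u ∈ τ.verts, t.outDeg (f u) = τ.outDeg u
  step : ∀ u i, u ++ [i] ∈ τ.verts → f u ++ [i] <+: f (u ++ [i])

namespace IsEmb

variable {τ t : PlaneTree} {f g : List ℕ → List ℕ} {u v : List ℕ} {i : ℕ}

theorem map_prefix (hf : IsEmb τ t f) (hv : v ∈ τ.verts) (h : u <+: v) : f u <+: f v := by
  obtain ⟨s, rfl⟩ := h
  induction s using List.reverseRecOn with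
  | nil => simp
  | append_singleton s i ih =>
    rw [← List.append_assoc] at hv ⊢
    exact (ih (τ.parent_mem _ _ hv)).trans (hf.step _ _ hv).of_snoc

theorem map_snoc_prefix (hf : IsEmb τ t f) (hv : v ∈ τ.verts) (h : u ++ [i] <+: v) :
    f u ++ [i] <+: f v :=
  (hf.step _ _ (mem_of_prefix h hv)).trans (hf.map_prefix hv h)

theorem prefix_iff (hf : IsEmb τ t f) (hu : u ∈ τ.verts) (hv : v ∈ τ.verts) :
    u <+: v ↔ f u <+: f v := by
  refine ⟨hf.map_prefix hv, fun h => ?_⟩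
  rcases prefix_or_branch u v with h' | h' | ⟨x, i, j, hij, h1, h2⟩
  · exact h'
  · rcases h'.eq_or_snoc with rfl | ⟨i, hi⟩
    · exact List.prefix_rfl
    · exact absurd ((hf.map_snoc_prefix hu hi).trans h) not_snoc_prefix_self
  · exact absurd (snoc_prefix_inj ((hf.map_snoc_prefix hu h1).trans h)
      (hf.map_snoc_prefix hv h2)) hij

theorem inj (hf : IsEmb τ t f) (hu : u ∈ τ.verts) (hv : v ∈ τ.verts) (h : f u = f v) : u = v :=
  ((hf.prefix_iff hu hv).2 (h ▸ List.prefix_rfl)).antisymm'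
    ((hf.prefix_iff hv hu).2 (h ▸ List.prefix_rfl))

theorem map_lt (hf : IsEmb τ t f) (hu : u ∈ τ.verts) (hv : v ∈ τ.verts) (h : u < v) :
    f u < f v := by
  rcases prefix_or_branch u v with h' | h' | ⟨x, i, j, hij, h1, h2⟩
  · exact lt_of_prefix_of_ne (hf.map_prefix hv h') fun he => h.ne (hf.inj hu hv he)
  · exact absurd h (not_lt.2 (by
      rcases eq_or_ne v u with rfl | hne
      · exact le_rfl
      · exact (lt_of_prefix_of_ne h' hne).le))
  · rw [lt_iff_of_branch hij h1 h2] at h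
    exact (lt_iff_of_branch hij (hf.map_snoc_prefix hu h1) (hf.map_snoc_prefix hv h2)).2 h

theorem lt_iff (hf : IsEmb τ t f) (hu : u ∈ τ.verts) (hv : v ∈ τ.verts) :
    u < v ↔ f u < f v := by
  refine ⟨hf.map_lt hu hv, fun h => ?_⟩
  rcases lt_trichotomy u v with h' | rfl | h'
  · exact h'
  · exact absurd h (lt_irrefl _)
  · exact absurd h (hf.map_lt hv hu h').asymm

theorem map_leaf (hf : IsEmb τ t f) (hu : u ∈ τ.leaves) : f u ∈ t.leaves := by
  rw [mem_leaves] at hu ⊢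
  exact ⟨hf.mem _ hu.1, (hf.outDeg_eq _ hu.1).trans hu.2⟩

theorem exists_leaf_above (hτ : ∀ v ∈ τ.verts, v ∉ τ.leaves → 2 ≤ τ.outDeg v)
    (hu : u ∈ τ.verts) (hl : u ∉ τ.leaves) :
    ∃ a ∈ τ.leaves, ∃ b ∈ τ.leaves, u ++ [0] <+: a ∧ u ++ [1] <+: b := by
  have h2 := hτ u hu hl
  obtain ⟨a, ha, ha'⟩ := τ.exists_leaf (snoc_mem_iff.2 (show 0 < τ.outDeg u by omega))
  obtain ⟨b, hb, hb'⟩ := τ.exists_leaf (snoc_mem_iff.2 (show 1 < τ.outDeg u by omega))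
  exact ⟨a, ha, b, hb, ha', hb'⟩

/-- The image of a vertex is the meet of the images of the leaves above it. -/
theorem prefix_of_leaves (hf : IsEmb τ t f)
    (hτ : ∀ v ∈ τ.verts, v ∉ τ.leaves → 2 ≤ τ.outDeg v) (hu : u ∈ τ.verts) {w : List ℕ}
    (hw : ∀ l ∈ τ.leaves, u <+: l → w <+: f l) : w <+: f u := by
  by_cases hl : u ∈ τ.leaves
  · exact hw u hl List.prefix_rfl
  · obtain ⟨a, ha, b, hb, ha', hb'⟩ := exists_leaf_above hτ hu hl
    exact prefix_of_branch zero_ne_one (hf.map_snoc_prefix (mem_leaves.1 ha).1 ha')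
      (hf.map_snoc_prefix (mem_leaves.1 hb).1 hb') (hw a ha ha'.of_snoc) (hw b hb hb'.of_snoc)

/-- At each vertex both values are the meet of the same leaf images. Hence a labelled tree
determines the drawing that respects its labels, and counting pairs of a drawing and a labelling
counts no labelling twice. -/
theorem eqOn_of_leaves (hf : IsEmb τ t f) (hg : IsEmb τ t g)
    (hτ : ∀ v ∈ τ.verts, v ∉ τ.leaves → 2 ≤ τ.outDeg v)
    (h : ∀ l ∈ τ.leaves, f l = g l) (hu : u ∈ τ.verts) : f u = g u := by
  refine List.IsPrefix.antisymm' (hg.prefix_of_leaves hτ hu fun l hl hul => ?_)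
    (hf.prefix_of_leaves hτ hu fun l hl hul => ?_)
  · rw [← h l hl]
    exact hf.map_prefix (mem_leaves.1 hl).1 hul
  · rw [h l hl]
    exact hg.map_prefix (mem_leaves.1 hl).1 hul

end IsEmb

end PlaneTree

/-! ### Induced trees are label-preserving drawings -/

namespace LabelledTree

open PlaneTree

variable {L : Type*} {T : LabelledTree L} {S : Finset L} {τ : LabelledTree S}

theorem pos_mem_leaves (T : LabelledTree L) (s : L) : T.pos s ∈ T.leaves := by
  have : T.pos s ∈ (T.leaves : Set (List ℕ)) := T.range_pos ▸ Set.mem_range_self s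
  exact this

theorem pos_mem (T : LabelledTree L) (s : L) : T.pos s ∈ T.verts :=
  (mem_leaves.1 (T.pos_mem_leaves s)).1

theorem exists_pos_eq (T : LabelledTree L) {l : List ℕ} (hl : l ∈ T.leaves) :
    ∃ s, T.pos s = l := by
  have : l ∈ Set.range T.pos := T.range_pos ▸ hl
  exact this

theorem IsLCA.unique {v w : List ℕ} (hv : T.IsLCA S v) (hw : T.IsLCA S w) : v = w :=
  (hw.2.2 v hv.1 hv.2.1).antisymm' (hv.2.2 w hw.1 hw.2.1)

theorem isLCA_of_isEmb {f : List ℕ → List ℕ}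
    (hτ : ∀ v ∈ τ.verts, v ∉ τ.leaves → 2 ≤ τ.outDeg v)
    (hf : IsEmb τ.toPlaneTree T.toPlaneTree f) (hpos : ∀ s : S, f (τ.pos s) = T.pos s) :
    T.IsLCA S (f []) := by
  refine ⟨hf.mem _ τ.root_mem, fun s hs => ?_, fun w hw hws => ?_⟩
  · rw [← hpos ⟨s, hs⟩]
    exact hf.map_prefix (τ.pos_mem _) List.nil_prefix
  · refine hf.prefix_of_leaves hτ τ.root_mem fun l hl _ => ?_
    obtain ⟨s, rfl⟩ := τ.exists_pos_eq hl
    rw [hpos s]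
    exact hws s s.2

theorem mem_lcaSubtree_iff {v u : List ℕ} (hv : T.IsLCA S v) :
    u ∈ T.lcaSubtree S ↔ v <+: u ∧ ∃ s ∈ S, u <+: T.pos s :=
  ⟨fun ⟨_, hw, h, h'⟩ => ⟨hw.unique hv ▸ h, h'⟩, fun h => ⟨v, hv, h⟩⟩

/-- The retained vertices are the image of the drawing. The children of `f u` in the LCA subtree
correspond to those of `u` in `τ`, so their number is not one; any other vertex of the subtree is
interior to the path that replaces an edge of `τ`, and has one child there. -/
theorem induces_of_isEmb {f : List ℕ → List ℕ}
    (hτ : ∀ v ∈ τ.verts, v ∉ τ.leaves → 2 ≤ τ.outDeg v)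
    (hf : IsEmb τ.toPlaneTree T.toPlaneTree f) (hpos : ∀ s : S, f (τ.pos s) = T.pos s) :
    T.Induces S τ := by
  have hlca := isLCA_of_isEmb hτ hf hpos
  have hsub (u : List ℕ) : u ∈ T.lcaSubtree S ↔ f [] <+: u ∧ ∃ s : S, u <+: f (τ.pos s) := by
    rw [mem_lcaSubtree_iff hlca]
    simp [hpos]
  have hbelow {u : List ℕ} {j : ℕ} {s : S} (hu : u ∈ τ.verts)
      (h : f u ++ [j] <+: f (τ.pos s)) : u ++ [j] <+: τ.pos s := by
    rcases ((hf.prefix_iff hu (τ.pos_mem s)).2 h.of_snoc).eq_or_snoc with rfl | ⟨i, hi⟩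
    · exact absurd h not_snoc_prefix_self
    · rwa [snoc_prefix_inj h (hf.map_snoc_prefix (τ.pos_mem s) hi)]
  have habove {u : List ℕ} (hu : u ∈ τ.verts) : ∃ s : S, u <+: τ.pos s := by
    obtain ⟨l, hl, hul⟩ := τ.exists_leaf hu
    obtain ⟨s, rfl⟩ := τ.exists_pos_eq hl
    exact ⟨s, hul⟩
  refine ⟨f, ⟨?_, fun u hu v hv h => hf.inj hu hv h, ?_⟩,
    fun u hu v hv => hf.prefix_iff hu hv, fun u hu v hv => hf.lt_iff hu hv, hpos, hf.outDeg_eq⟩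
  · intro u hu
    have hu' : u ∈ τ.verts := hu
    obtain ⟨s, hs⟩ := habove hu'
    refine ⟨(hsub _).2 ⟨hf.map_prefix hu' List.nil_prefix, s, hf.map_prefix (τ.pos_mem s) hs⟩,
      Or.inr ?_⟩
    have hset : {i : ℕ | f u ++ [i] ∈ T.lcaSubtree S} = {i | u ++ [i] ∈ τ.verts} := by
      ext i
      simp only [Set.mem_ofPred_eq, hsub]
      constructor
      · rintro ⟨-, s, hs⟩
        exact mem_of_prefix (hbelow hu' hs) (τ.pos_mem s)
      · intro h
        obtain ⟨s, hs⟩ := habove h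
        exact ⟨(hf.map_prefix hu' List.nil_prefix).trans (List.prefix_append _ _), s,
          hf.map_snoc_prefix (τ.pos_mem s) hs⟩
    rw [hset]
    change τ.outDeg u ≠ 1
    by_cases hl : u ∈ τ.leaves
    · simp [(mem_leaves.1 hl).2]
    · have := hτ u hu' hl
      omega
  · rintro w ⟨hw, hw'⟩
    by_contra hnot
    have hnot' : ∀ u ∈ τ.verts, f u ≠ w := fun u hu h => hnot ⟨u, hu, h⟩
    have hone : {i : ℕ | w ++ [i] ∈ T.lcaSubtree S}.ncard ≠ 1 :=
      hw'.resolve_left fun h => hnot' [] τ.root_mem (hlca.unique h)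
    obtain ⟨hw0, s, hs⟩ := (hsub w).1 hw
    -- Take the deepest `u` on the way to `τ.pos s` whose image is above `w`. Then `w` lies strictly
    -- between `f u` and the image of the next vertex, so its only child in the subtree is the one
    -- towards that image.
    obtain ⟨u, hu, hmax⟩ := Finset.exists_max_image
      (τ.verts.filter fun u => u <+: τ.pos s ∧ f u <+: w) List.length
      ⟨[], by simp [τ.root_mem, hw0]⟩
    simp only [Finset.mem_filter] at hu hmax
    obtain ⟨hu, hus, huw⟩ := hu
    obtain ⟨j, hj⟩ : ∃ j, u ++ [j] <+: τ.pos s := by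
      refine hus.eq_or_snoc.resolve_left ?_
      rintro rfl
      exact hnot' _ hu (huw.antisymm' hs)
    have hjm := mem_of_prefix hj (τ.pos_mem s)
    have hjw : ¬ f (u ++ [j]) <+: w := fun h => by
      have := hmax _ ⟨hjm, hj, h⟩
      simp at this
    have hwj : w <+: f (u ++ [j]) :=
      (List.prefix_or_prefix_of_prefix hs (hf.map_prefix (τ.pos_mem s) hj)).resolve_right hjw
    obtain ⟨k, hk⟩ := hwj.eq_or_snoc.resolve_left fun h => hnot' _ hjm h.symm
    obtain ⟨j', hj'⟩ := huw.eq_or_snoc.resolve_left (hnot' u hu)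
    obtain rfl : j' = j := snoc_prefix_inj (hj'.trans hwj) (hf.step _ _ hjm)
    refine hone (Set.ncard_eq_one.2 ⟨k, ?_⟩)
    ext k'
    simp only [Set.mem_ofPred_eq, hsub, Set.mem_singleton_iff]
    constructor
    · rintro ⟨-, s', hs'⟩
      have h1 : f u ++ [j'] <+: f (τ.pos s') := hj'.trans hs'.of_snoc
      exact snoc_prefix_inj hs' (hk.trans (hf.map_prefix (τ.pos_mem s') (hbelow hu h1)))
    · rintro rfl
      exact ⟨hw0.trans (List.prefix_append _ _), s,
        hk.trans (hf.map_prefix (τ.pos_mem s) hj)⟩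

/-- Equal out-degrees let the children of `u` define a map `c` from `Fin (τ.outDeg u)` to itself,
recording below which child of `f u` each image lies. Preservation of the order makes `c` strictly
increasing, hence the identity. -/
theorem Induces.exists_isEmb (h : T.Induces S τ) :
    ∃ f, IsEmb τ.toPlaneTree T.toPlaneTree f ∧ ∀ s : S, f (τ.pos s) = T.pos s := by
  obtain ⟨f, hbij, hpre, hlt, hpos, hdeg⟩ := h
  have hsub {u : List ℕ} (hu : u ∈ τ.verts) : f u ∈ T.lcaSubtree S := (hbij.mapsTo hu).1
  have hmem : ∀ u ∈ τ.verts, f u ∈ T.verts := fun u hu => by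
    obtain ⟨v, -, -, s, -, hs⟩ := hsub hu
    exact mem_of_prefix hs (T.pos_mem s)
  refine ⟨f, ⟨hmem, hdeg, ?_⟩, hpos⟩
  intro u
  by_cases hu : u ∈ τ.verts
  swap
  · exact fun i hi => absurd (τ.parent_mem _ _ hi) hu
  have hc (i : Fin (τ.outDeg u)) : ∃ c : Fin (τ.outDeg u), 
      f u ++ [(c : ℕ)] <+: f (u ++ [(i : ℕ)]) := by
    have hi := snoc_mem_iff.2 i.2
    rcases ((hpre u hu _ hi).1 (List.prefix_append _ _)).eq_or_snoc with he | ⟨c, hc⟩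
    · have := (hpre _ hi u hu).2 (he ▸ List.prefix_rfl)
      exact absurd this not_snoc_prefix_self
    · refine ⟨⟨c, ?_⟩, hc⟩
      rw [← hdeg u hu]
      exact snoc_mem_iff.1 (mem_of_prefix hc (hmem _ hi))
  choose c hc using hc
  have hmono : StrictMono c := by
    intro i j hij
    have hi := snoc_mem_iff.2 i.2
    have hj := snoc_mem_iff.2 j.2
    have hne : (i : ℕ) ≠ j := fun h => hij.ne (Fin.ext h)
    have hbr : ∀ a b : ℕ, a ≠ b → ¬ u ++ [a] <+: u ++ [b] := fun a b hab h => hab (by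
      simpa using h)
    rcases prefix_or_branch (f (u ++ [(i : ℕ)])) (f (u ++ [(j : ℕ)])) with h | h | ⟨x, k, l, hkl, hk, hl⟩
    · exact absurd ((hpre _ hi _ hj).2 h) (hbr _ _ hne)
    · exact absurd ((hpre _ hj _ hi).2 h) (hbr _ _ hne.symm)
    · have hux : f u <+: x := prefix_of_branch hkl hk hl (hc i).of_snoc (hc j).of_snoc
      have hlt' : k < l := by
        rw [← lt_iff_of_branch hkl hk hl, ← hlt _ hi _ hj,
          lt_iff_of_branch hne List.prefix_rfl List.prefix_rfl]
        exact hij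
      have hx : x = f u := by
        obtain ⟨v, hv, hvu, -⟩ := hsub hu
        have hmemx {y z : List ℕ} (hz : z ∈ τ.verts) (hxy : x <+: y) (hy : y <+: f z) :
            y ∈ T.lcaSubtree S := by
          obtain ⟨-, -, -, s, hs, hs'⟩ := hsub hz
          exact ⟨v, hv, hvu.trans (hux.trans hxy), s, hs, hy.trans hs'⟩
        -- The vertex `x` where the two images part has two children in the LCA subtree, so it is
        -- retained and is the image of a common ancestor of two children of `u`. It is therefore `f
        -- u` itself.
        have hxr : x ∈ T.retained S := by
          refine ⟨hmemx hi List.prefix_rfl hk.of_snoc, Or.inr fun h1 => ?_⟩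
          obtain ⟨m, hm⟩ := Set.ncard_eq_one.1 h1
          have h2 : k ∈ ({m} : Set ℕ) := hm ▸ hmemx hi (List.prefix_append _ _) hk
          have h3 : l ∈ ({m} : Set ℕ) := hm ▸ hmemx hj (List.prefix_append _ _) hl
          exact hkl (h2.trans h3.symm)
        obtain ⟨w, hw, rfl⟩ := hbij.surjOn hxr
        have hwu : w <+: u := prefix_of_branch hne List.prefix_rfl List.prefix_rfl
          ((hpre _ hw _ hi).2 hk.of_snoc) ((hpre _ hw _ hj).2 hl.of_snoc)
        exact ((hpre _ hw _ hu).1 hwu).antisymm' hux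
      subst hx
      rw [Fin.lt_def, snoc_prefix_inj (hc i) hk, snoc_prefix_inj (hc j) hl]
      exact hlt'
  intro i hi
  have hi' := snoc_mem_iff.1 hi
  have h := hc ⟨i, hi'⟩
  rwa [le_antisymm hmono.apply_le hmono.le_apply] at h

theorem induces_iff (hτ : ∀ v ∈ τ.verts, v ∉ τ.leaves → 2 ≤ τ.outDeg v) :
    T.Induces S τ ↔
      ∃ f, IsEmb τ.toPlaneTree T.toPlaneTree f ∧ ∀ s : S, f (τ.pos s) = T.pos s :=
  ⟨Induces.exists_isEmb, fun ⟨_, hf, hpos⟩ => induces_of_isEmb hτ hf hpos⟩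

end LabelledTree

/-! ### Counting drawings recursively -/

namespace PlaneTree

/-- The drawings of `τ` into `t`, extended by `[]` outside of `τ`. -/
def embSet (τ t : PlaneTree) : Set (List ℕ → List ℕ) :=
  {f | IsEmb τ t f ∧ ∀ u ∉ τ.verts, f u = []}

/-- The number of drawings of `τ` into `t`. -/
noncomputable def embCount (τ t : PlaneTree) : ℕ := Nat.card (embSet τ t)

instance finite_embSet (τ t : PlaneTree) : Finite (embSet τ t) := by
  refine Finite.of_injective (β := τ.verts → t.verts)
    (fun f u => ⟨f.1 u, f.2.1.mem u u.2⟩) fun f g h => Subtype.ext (funext fun u => ?_)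
  by_cases hu : u ∈ τ.verts
  · exact congrArg Subtype.val (congrFun h ⟨u, hu⟩)
  · rw [f.2.2 u hu, g.2.2 u hu]

variable {τ : PlaneTree} {m d : ℕ} {ts : Fin m → PlaneTree} {τs : Fin d → PlaneTree}

open Classical in
theorem isEmb_cons_iff {k : Fin m} {f : List ℕ → List ℕ} :
    IsEmb τ (node m ts) (fun u => if u ∈ τ.verts then (k : ℕ) :: f u else []) ↔
      IsEmb τ (ts k) f := by
  constructor
  · intro h
    refine ⟨fun u hu => ?_, fun u hu => ?_, fun u i hi => ?_⟩
    · simpa [hu, cons_mem_node_fin] using h.mem u hu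
    · simpa [hu] using h.outDeg_eq u hu
    · simpa [hi, τ.parent_mem _ _ hi] using h.step u i hi
  · intro h
    refine ⟨fun u hu => ?_, fun u hu => ?_, fun u i hi => ?_⟩
    · simpa [hu, cons_mem_node_fin] using h.mem u hu
    · simpa [hu] using h.outDeg_eq u hu
    · simpa [hi, τ.parent_mem _ _ hi] using h.step u i hi

open Classical in
-- Drawings preserve descent: once the root of `τ` goes into the `k`-th branch, all of `τ` is drawn
-- into that branch.
theorem embCount_node_eq_add :
    embCount τ (node m ts) =
      Nat.card {f : embSet τ (node m ts) // f.1 [] = []} + ∑ k, embCount τ (ts k) := by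
  let F : {f : embSet τ (node m ts) // f.1 [] = []} ⊕ (Σ k, embSet τ (ts k)) →
      embSet τ (node m ts) := Sum.elim Subtype.val fun x =>
    ⟨fun u => if u ∈ τ.verts then (x.1 : ℕ) :: x.2.1 u else [], isEmb_cons_iff.2 x.2.2.1,
      fun u hu => by simp [hu]⟩
  have hF : Function.Bijective F := by
    constructor
    · rintro (f | ⟨k, f⟩) (g | ⟨l, g⟩) h
      · exact congrArg _ (Subtype.ext h)
      · have := congrFun (congrArg Subtype.val h) []
        simp [F, f.2, τ.root_mem] at this
      · have := congrFun (congrArg Subtype.val h) []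
        simp [F, g.2, τ.root_mem] at this
      · have h0 := congrFun (congrArg Subtype.val h)
        simp only [F, Sum.elim_inr] at h0
        obtain rfl : k = l := by
          have := h0 []
          simp only [τ.root_mem, if_true, List.cons.injEq] at this
          exact Fin.ext this.1
        congr 2
        refine Subtype.ext (funext fun u => ?_)
        by_cases hu : u ∈ τ.verts
        · simpa [hu] using h0 u
        · rw [f.2.2 u hu, g.2.2 u hu]
    · intro f
      rcases hf : f.1 [] with _ | ⟨k, w⟩
      · exact ⟨Sum.inl ⟨f, hf⟩, rfl⟩
      · obtain ⟨hk, -⟩ := cons_mem_node.1 (hf ▸ f.2.1.mem [] τ.root_mem)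
        have hcons : ∀ u ∈ τ.verts, f.1 u = k :: (f.1 u).tail := fun u hu => by
          have h := f.2.1.map_prefix hu List.nil_prefix
          rw [hf] at h
          obtain ⟨s, hs⟩ := h
          simp [← hs]
        have heq : f.1 = fun u => if u ∈ τ.verts then
            ((⟨k, hk⟩ : Fin m) : ℕ) :: (fun u => (f.1 u).tail) u else [] := by
          funext u
          by_cases hu : u ∈ τ.verts
          · simpa [hu] using hcons u hu
          · simp [hu, f.2.2 u hu]
        refine ⟨Sum.inr ⟨⟨k, hk⟩, fun u => (f.1 u).tail, ?_, fun u hu => ?_⟩,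
          Subtype.ext heq.symm⟩
        · have := f.2.1
          rw [heq] at this
          exact isEmb_cons_iff.1 this
        · simp [f.2.2 u hu]
  rw [embCount, ← Nat.card_congr (Equiv.ofBijective F hF), Nat.card_sum, Nat.card_sigma]
  rfl

open Classical in
/-- The map that draws the subtree `τs i` at the `i`-th child by means of `g i`. -/
noncomputable def nodeMap (τs : Fin d → PlaneTree) (g : Fin d → List ℕ → List ℕ) :
    List ℕ → List ℕ
  | [] => []
  | k :: u => if h : k < d then if u ∈ (τs ⟨k, h⟩).verts then k :: g ⟨k, h⟩ u else [] else []

theorem nodeMap_cons {g : Fin d → List ℕ → List ℕ} {k : Fin d} {u : List ℕ}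
    (hu : u ∈ (τs k).verts) : nodeMap τs g (k :: u) = (k : ℕ) :: g k u := by
  simp [nodeMap, hu]

theorem nodeMap_of_notMem {g : Fin d → List ℕ → List ℕ} {u : List ℕ}
    (hu : u ∉ (node d τs).verts) : nodeMap τs g u = [] := by
  rcases u with _ | ⟨k, u⟩
  · rfl
  · rw [cons_mem_node] at hu
    push Not at hu
    by_cases h : k < d <;> simp [nodeMap, h, hu]

theorem isEmb_nodeMap_iff {ts : Fin d → PlaneTree} {g : Fin d → List ℕ → List ℕ} :
    IsEmb (node d τs) (node d ts) (nodeMap τs g) ↔ ∀ k, IsEmb (τs k) (ts k) (g k) := by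
  constructor
  · intro h k
    refine ⟨fun u hu => ?_, fun u hu => ?_, fun u i hi => ?_⟩
    · simpa [nodeMap_cons hu, cons_mem_node_fin] using h.mem (k :: u) (cons_mem_node_fin.2 hu)
    · simpa [nodeMap_cons hu] using h.outDeg_eq (k :: u) (cons_mem_node_fin.2 hu)
    · simpa [nodeMap_cons hi, nodeMap_cons ((τs k).parent_mem _ _ hi)] using
        h.step (k :: u) i (cons_mem_node_fin.2 hi)
  · intro h
    refine ⟨?_, ?_, ?_⟩
    · rintro (_ | ⟨k, u⟩) hu
      · exact root_mem _
      · obtain ⟨hk, hu⟩ := cons_mem_node.1 hu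
        rw [nodeMap_cons (k := ⟨k, hk⟩) hu, cons_mem_node_fin]
        exact (h _).mem u hu
    · rintro (_ | ⟨k, u⟩) hu
      · simp [nodeMap]
      · obtain ⟨hk, hu⟩ := cons_mem_node.1 hu
        rw [nodeMap_cons (k := ⟨k, hk⟩) hu, outDeg_node_cons, (h _).outDeg_eq u hu]
        exact (outDeg_node_cons (⟨k, hk⟩ : Fin d) u).symm
    · rintro (_ | ⟨k, u⟩) i hu
      · obtain ⟨hk, hu⟩ := cons_mem_node.1 hu
        change _ <+: nodeMap τs g (i :: [])
        rw [nodeMap_cons (k := ⟨i, hk⟩) hu]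
        simp [nodeMap]
      · rw [List.cons_append] at hu ⊢
        obtain ⟨hk, hu⟩ := cons_mem_node.1 hu
        rw [nodeMap_cons (k := ⟨k, hk⟩) hu,
          nodeMap_cons (k := ⟨k, hk⟩) ((τs ⟨k, hk⟩).parent_mem _ _ hu)]
        simpa using (h _).step u i hu

open Classical in
-- When the root goes to the root, the condition on steps forces the `i`-th branch of `τ` into the
-- `i`-th branch of the target, and the branches are then drawn independently.
theorem card_embSet_root {ts : Fin d → PlaneTree} :
    Nat.card {f : embSet (node d τs) (node d ts) // f.1 [] = []} =
      ∏ i, embCount (τs i) (ts i) := by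
  let F : (∀ i, embSet (τs i) (ts i)) → {f : embSet (node d τs) (node d ts) // f.1 [] = []} :=
    fun g => ⟨⟨nodeMap τs fun i => (g i).1, isEmb_nodeMap_iff.2 fun i => (g i).2.1,
      fun u hu => nodeMap_of_notMem hu⟩, rfl⟩
  have hF : Function.Bijective F := by
    constructor
    · intro f g h
      refine funext fun i => Subtype.ext (funext fun u => ?_)
      by_cases hu : u ∈ (τs i).verts
      · have := congrFun (congrArg (fun x => x.1.1) h) ((i : ℕ) :: u)
        simpa [F, nodeMap_cons hu] using this
      · rw [(f i).2.2 u hu, (g i).2.2 u hu]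
    · rintro ⟨⟨f, hf, hf0⟩, hroot⟩
      simp only at hroot
      have heq : f = nodeMap τs
          fun i u => if u ∈ (τs i).verts then (f ((i : ℕ) :: u)).tail else [] := by
        funext u
        by_cases hu : u ∈ (node d τs).verts
        · rcases u with _ | ⟨k, u⟩
          · rw [hroot, nodeMap]
          · obtain ⟨hk, hu'⟩ := cons_mem_node.1 hu
            rw [nodeMap_cons (k := ⟨k, hk⟩) hu', if_pos hu']
            have h := hf.map_snoc_prefix (u := []) (i := k) hu (by simp)
            rw [hroot] at h
            obtain ⟨s, hs⟩ := h
            simp [← hs]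
        · rw [hf0 u hu, nodeMap_of_notMem hu]
      have hg := hf
      rw [heq, isEmb_nodeMap_iff] at hg
      exact ⟨fun i => ⟨_, hg i, fun u hu => by simp [hu]⟩,
        Subtype.ext (Subtype.ext heq.symm)⟩
  rw [← Nat.card_congr (Equiv.ofBijective F hF), Nat.card_pi]
  rfl

theorem card_embSet_root_of_ne (h : m ≠ d) :
    Nat.card {f : embSet (node d τs) (node m ts) // f.1 [] = []} = 0 := by
  have : IsEmpty {f : embSet (node d τs) (node m ts) // f.1 [] = []} := by
    refine ⟨fun f => h ?_⟩
    have := f.1.2.1.outDeg_eq [] (root_mem _)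
    rwa [f.2, outDeg_node_nil, outDeg_node_nil] at this
  exact Nat.card_of_isEmpty

end PlaneTree

/-! ### Weighted generating functions over [0, ∞] -/

namespace PowerSeries

/-- The generating function of the objects `a : α` with sizes `s a` and weights `w a`. -/
noncomputable def gf {α : Type*} (s : α → ℕ) (w : α → ℝ≥0∞) : PowerSeries ℝ≥0∞ :=
  mk fun n => ∑' a, if s a = n then w a else 0

variable {α β : Type*} {s : α → ℕ} {w : α → ℝ≥0∞} {s' : β → ℕ} {w' : β → ℝ≥0∞}

theorem coeff_gf (n : ℕ) : coeff n (gf s w) = ∑' a, if s a = n then w a else 0 := coeff_mk _ _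

theorem gf_comp_equiv (e : β ≃ α) : gf (fun b => s (e b)) (fun b => w (e b)) = gf s w := by
  ext n
  rw [coeff_gf, coeff_gf]
  exact Equiv.tsum_eq e (fun a => (if s a = n then w a else 0 : ℝ≥0∞))

theorem gf_prod :
    gf (fun x : α × β => s x.1 + s' x.2) (fun x => w x.1 * w' x.2) = gf s w * gf s' w' := by
  ext n
  simp only [coeff_mul, coeff_gf, ← ENNReal.tsum_mul_left, ← ENNReal.tsum_mul_right]
  rw [ENNReal.tsum_prod', ENNReal.tsum_comm, ← Summable.tsum_finsetSum fun _ _ => ENNReal.summable]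
  refine tsum_congr fun b => ?_
  rw [← Summable.tsum_finsetSum fun _ _ => ENNReal.summable]
  refine tsum_congr fun a => ?_
  simp only [ite_mul, mul_ite, zero_mul, mul_zero]
  by_cases h : s a + s' b = n
  · rw [Finset.sum_eq_single (s a, s' b)]
    · simp [h]
    · rintro ⟨i, j⟩ - hne
      by_cases h1 : s a = i <;> by_cases h2 : s' b = j <;> simp_all
    · simp [h]
  · rw [if_neg h, Finset.sum_eq_zero]
    rintro ⟨i, j⟩ hij
    rw [Finset.HasAntidiagonal.mem_antidiagonal] at hij
    by_cases h1 : s a = i <;> by_cases h2 : s' b = j <;> simp_all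

theorem gf_pi {d : ℕ} (s : Fin d → α → ℕ) (w : Fin d → α → ℝ≥0∞) :
    gf (fun a : Fin d → α => ∑ i, s i (a i)) (fun a => ∏ i, w i (a i)) =
      ∏ i, gf (s i) (w i) := by
  induction d with
  | zero =>
    ext n
    rw [coeff_gf, tsum_eq_single (fun i => i.elim0) fun b hb =>
      absurd (Subsingleton.elim _ _) hb]
    simp [coeff_one, eq_comm]
  | succ d ih =>
    rw [Fin.prod_univ_succ, ← ih, ← gf_prod, ← gf_comp_equiv (Fin.consEquiv fun _ => α)]
    simp [Fin.consEquiv, Fin.sum_univ_succ, Fin.prod_univ_succ]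

theorem gf_const_mul (c : ℝ≥0∞) : gf s (fun a => c * w a) = C c * gf s w := by
  ext n
  rw [coeff_C_mul, coeff_gf, coeff_gf, ← ENNReal.tsum_mul_left]
  simp

theorem gf_add (w' : α → ℝ≥0∞) : gf s (fun a => w a + w' a) = gf s w + gf s w' := by
  ext n
  rw [map_add, coeff_gf, coeff_gf, coeff_gf, ← ENNReal.tsum_add]
  refine tsum_congr fun a => ?_
  split_ifs <;> simp

theorem gf_sum {ι : Type*} (I : Finset ι) (w : ι → α → ℝ≥0∞) :
    gf s (fun a => ∑ k ∈ I, w k a) = ∑ k ∈ I, gf s (w k) := by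
  ext n
  simp only [map_sum, coeff_gf]
  rw [← Summable.tsum_finsetSum fun _ _ => ENNReal.summable]
  refine tsum_congr fun a => ?_
  split_ifs <;> simp

theorem coeff_gf_sigma {γ : ℕ → Type*} (s : (Σ d, γ d) → ℕ) (w : (Σ d, γ d) → ℝ≥0∞) (n : ℕ) :
    coeff n (gf s w) = ∑' d, coeff n (gf (fun a : γ d => s ⟨d, a⟩) fun a => w ⟨d, a⟩) := by
  simp only [coeff_gf]
  exact ENNReal.tsum_sigma' _

end PowerSeries

/-! ### Generating functions of trees and of drawings -/

namespace PlaneTree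

open PowerSeries

/-- The weight of a tree as an extended nonnegative number. -/
noncomputable def eweight (p : ℕ → ℝ) (t : PlaneTree) : ℝ≥0∞ := ENNReal.ofReal (t.weight p)

variable {p : ℕ → ℝ} {m d : ℕ} {ts : Fin m → PlaneTree} {τ : PlaneTree}

theorem weight_nonneg (hp : ∀ j, 0 ≤ p j) (t : PlaneTree) : 0 ≤ t.weight p :=
  Finset.prod_nonneg fun _ _ => hp _

theorem eweight_node (hp : ∀ j, 0 ≤ p j) :
    (node m ts).eweight p = ENNReal.ofReal (p m) * ∏ i, (ts i).eweight p := by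
  rw [eweight, weight_node, ENNReal.ofReal_mul (hp m),
    ENNReal.ofReal_prod_of_nonneg fun i _ => weight_nonneg hp _]
  rfl

/-- The generating function of the plane trees by their number of leaves. -/
noncomputable def leafGF (p : ℕ → ℝ) : PowerSeries ℝ≥0∞ := gf (fun t => t.leaves.card) (eweight p)

/-- The generating function of the plane trees with a drawing of `τ`. -/
noncomputable def embGF (p : ℕ → ℝ) (τ : PlaneTree) : PowerSeries ℝ≥0∞ :=
  gf (fun t => t.leaves.card) fun t => t.eweight p * embCount τ t

/-- The generating function of the sequences of trees that may surround one distinguished child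
of a vertex. -/
noncomputable def sideGF (p : ℕ → ℝ) : PowerSeries ℝ≥0∞ :=
  PowerSeries.mk fun n => ∑' m, ENNReal.ofReal (p m) * (m * coeff n (leafGF p ^ (m - 1)))

theorem coeff_gf_node (w : PlaneTree → ℝ≥0∞) (n : ℕ) :
    coeff n (gf (fun t => t.leaves.card) w) = ∑' d, coeff n
      (gf (fun ts : Fin d → PlaneTree => (node d ts).leaves.card) fun ts => w (node d ts)) := by
  rw [← gf_comp_equiv nodeEquiv, coeff_gf_sigma]
  rfl

/-- The size-and-weight generating function of a sequence of trees, seen as a single tree with a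
new root of weight one. -/
theorem gf_node_prod (w : Fin d → PlaneTree → ℝ≥0∞) :
    gf (fun ts : Fin d → PlaneTree => (node d ts).leaves.card) (fun ts => ∏ i, w i (ts i)) =
      if d = 0 then X else ∏ i, gf (fun t => t.leaves.card) (w i) := by
  simp_rw [card_leaves_node]
  split_ifs with h
  · subst h
    ext n
    rw [coeff_gf, tsum_eq_single (fun i => i.elim0) fun b hb =>
      absurd (Subsingleton.elim _ _) hb]
    simp [coeff_X, eq_comm]
  · simp_rw [zero_add]
    exact gf_pi (fun _ t => t.leaves.card) w

/-- Cut at the root. A root without children is itself a leaf, so `X` replaces the empty product. -/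
theorem coeff_leafGF (hp : ∀ j, 0 ≤ p j) (n : ℕ) :
    coeff n (leafGF p) =
      ∑' d, ENNReal.ofReal (p d) * coeff n (if d = 0 then X else leafGF p ^ d) := by
  rw [leafGF, coeff_gf_node]
  refine tsum_congr fun d => ?_
  simp_rw [eweight_node hp]
  rw [gf_const_mul, coeff_C_mul, gf_node_prod]
  simp

theorem gf_node_marked (w : PlaneTree → ℝ≥0∞) (k : Fin d) :
    gf (fun ts : Fin d → PlaneTree => (node d ts).leaves.card)
      (fun ts => (∏ i, (ts i).eweight p) * w (ts k)) =
      leafGF p ^ (d - 1) * gf (fun t => t.leaves.card) fun t => t.eweight p * w t := by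
  have h0 : d ≠ 0 := by
    rintro rfl
    exact k.elim0
  have h (ts : Fin d → PlaneTree) : (∏ i, (ts i).eweight p) * w (ts k) =
      ∏ i, (if i = k then (ts i).eweight p * w (ts i) else (ts i).eweight p) := by
    rw [← Finset.mul_prod_erase _ _ (Finset.mem_univ k),
      ← Finset.mul_prod_erase _ (fun i => ite (i = k) _ _) (Finset.mem_univ k), if_pos rfl,
      mul_right_comm]
    congr 1
    refine Finset.prod_congr rfl fun i hi => ?_
    rw [if_neg (Finset.ne_of_mem_erase hi)]
  simp_rw [h]
  rw [gf_node_prod (fun i t => if i = k then t.eweight p * w t else t.eweight p), if_neg h0,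
    ← Finset.mul_prod_erase _ _ (Finset.mem_univ k), mul_comm]
  simp only [if_true]
  congr 1
  rw [Finset.prod_congr rfl (g := fun _ => leafGF p) fun i hi => ?_]
  · simp
  · simp only [if_neg (Finset.ne_of_mem_erase hi)]
    rfl

/-- The first summand collects the drawings that send root to root, which needs out-degree `d` in
the target. In the second, the drawing lies in one of the `m` branches and the other `m - 1` are
arbitrary trees; summed over `m` this is the factor `sideGF p`. -/
theorem embGF_node (hp : ∀ j, 0 ≤ p j) {τs : Fin d → PlaneTree} :
    embGF p (node d τs) = C (ENNReal.ofReal (p d)) * (if d = 0 then X else ∏ i, embGF p (τs i)) +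
      sideGF p * embGF p (node d τs) := by
  ext n
  conv_lhs => rw [embGF, coeff_gf_node]
  have key (m : ℕ) : coeff n (gf (fun ts : Fin m → PlaneTree => (node m ts).leaves.card)
      fun ts => (node m ts).eweight p * embCount (node d τs) (node m ts)) =
      (if m = d then coeff n
        (C (ENNReal.ofReal (p d)) * (if d = 0 then X else ∏ i, embGF p (τs i))) else 0) +
      ENNReal.ofReal (p m) * (m * coeff n (leafGF p ^ (m - 1) * embGF p (node d τs))) := by
    simp_rw [eweight_node hp, embCount_node_eq_add, Nat.cast_add, Nat.cast_sum, mul_assoc, mul_add,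
      Finset.mul_sum]
    rw [gf_add, gf_const_mul, gf_sum, map_add]
    congr 1
    · split_ifs with h h'
      · subst h h'
        simp_rw [card_embSet_root, Nat.cast_prod, ← Finset.prod_mul_distrib]
        rw [gf_node_prod fun i t => t.eweight p * embCount (τs i) t, if_pos rfl]
      · subst h
        simp_rw [card_embSet_root, Nat.cast_prod, ← Finset.prod_mul_distrib]
        rw [gf_node_prod fun i t => t.eweight p * embCount (τs i) t, if_neg h']
        rfl
      · simp_rw [card_embSet_root_of_ne h]
        simp [coeff_gf]
    · simp_rw [gf_const_mul, gf_node_marked (fun t => (embCount (node d τs) t : ℝ≥0∞))]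
      rw [Finset.sum_const, Finset.card_univ, Fintype.card_fin, nsmul_eq_mul, ← mul_assoc,
        mul_comm (m : PowerSeries ℝ≥0∞), mul_assoc, coeff_C_mul, ← nsmul_eq_mul, map_nsmul,
        nsmul_eq_mul]
      rfl
  simp_rw [key]
  rw [ENNReal.tsum_add, tsum_ite_eq, map_add]
  congr 1
  simp_rw [coeff_mul, sideGF, coeff_mk, ← ENNReal.tsum_mul_right, Finset.mul_sum]
  rw [Summable.tsum_finsetSum fun _ _ => ENNReal.summable]
  simp_rw [mul_assoc]

end PlaneTree

/-! ### From extended nonnegative to real coefficients -/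

namespace PowerSeries

/-- All coefficients are finite. -/
def IsFin (θ : PowerSeries ℝ≥0∞) : Prop := ∀ n, coeff n θ ≠ ⊤

/-- The series of the real values of the coefficients. -/
noncomputable def realPart (θ : PowerSeries ℝ≥0∞) : PowerSeries ℝ := mk fun n => (coeff n θ).toReal

variable {θ ψ : PowerSeries ℝ≥0∞}

theorem coeff_realPart (n : ℕ) : coeff n (realPart θ) = (coeff n θ).toReal := coeff_mk _ _

theorem IsFin.mul (hθ : IsFin θ) (hψ : IsFin ψ) : IsFin (θ * ψ) := fun n => by
  rw [coeff_mul]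
  exact ENNReal.sum_ne_top.2 fun _ _ => ENNReal.mul_ne_top (hθ _) (hψ _)

theorem realPart_mul (hθ : IsFin θ) (hψ : IsFin ψ) :
    realPart (θ * ψ) = realPart θ * realPart ψ := by
  ext n
  rw [coeff_realPart, coeff_mul, coeff_mul,
    ENNReal.toReal_sum fun _ _ => ENNReal.mul_ne_top (hθ _) (hψ _)]
  simp [coeff_realPart]

theorem realPart_add (hθ : IsFin θ) (hψ : IsFin ψ) :
    realPart (θ + ψ) = realPart θ + realPart ψ := by
  ext n
  simp [coeff_realPart, ENNReal.toReal_add (hθ n) (hψ n)]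

theorem isFin_C {c : ℝ≥0∞} (hc : c ≠ ⊤) : IsFin (C c) := fun n => by
  rw [coeff_C]
  split_ifs <;> simp [hc]

theorem realPart_C (c : ℝ≥0∞) : realPart (C c) = C c.toReal := by
  ext n
  rw [coeff_realPart, coeff_C, coeff_C]
  split_ifs <;> simp

theorem isFin_X : IsFin X := fun n => by
  rw [coeff_X]
  split_ifs <;> simp

theorem realPart_X : realPart X = X := by
  ext n
  rw [coeff_realPart, coeff_X, coeff_X]
  split_ifs <;> simp

theorem isFin_prod {ι : Type*} {I : Finset ι} {θ : ι → PowerSeries ℝ≥0∞}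
    (h : ∀ i ∈ I, IsFin (θ i)) :
    IsFin (∏ i ∈ I, θ i) ∧ realPart (∏ i ∈ I, θ i) = ∏ i ∈ I, realPart (θ i) := by
  classical
  induction I using Finset.induction_on with
  | empty =>
    have h1 : (1 : PowerSeries ℝ≥0∞) = C 1 := (map_one _).symm
    rw [Finset.prod_empty, Finset.prod_empty, h1]
    exact ⟨isFin_C ENNReal.one_ne_top, by rw [realPart_C]; simp⟩
  | insert i I hi ih =>
    obtain ⟨h1, h2⟩ := ih fun j hj => h j (Finset.mem_insert_of_mem hj)
    have h3 := h i (Finset.mem_insert_self _ _)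
    rw [Finset.prod_insert hi, Finset.prod_insert hi, realPart_mul h3 h1, h2]
    exact ⟨h3.mul h1, rfl⟩

theorem IsFin.pow (hθ : IsFin θ) (d : ℕ) : IsFin (θ ^ d) := by
  simpa using (isFin_prod (I := Finset.range d) fun _ _ => hθ).1

theorem realPart_pow (hθ : IsFin θ) (d : ℕ) : realPart (θ ^ d) = realPart θ ^ d := by
  simpa using (isFin_prod (I := Finset.range d) fun _ _ => hθ).2

/-- `X ^ d` divides the power. For a fixed coefficient, this makes sums over all family sizes
finite. -/
theorem coeff_pow_of_lt {R : Type*} [CommSemiring R] {θ : PowerSeries R}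
    (h0 : constantCoeff θ = 0) {n d : ℕ} (h : n < d) : coeff n (θ ^ d) = 0 := by
  obtain ⟨ψ, rfl⟩ := X_dvd_iff.2 h0
  rw [mul_pow, coeff_X_pow_mul', if_neg (by omega)]

theorem coeff_subst_mk {c : ℕ → ℝ} {Φ : PowerSeries ℝ} (h0 : constantCoeff Φ = 0) {n N : ℕ}
    (hN : n < N) : coeff n ((mk c).subst Φ) = ∑ d ∈ Finset.range N, c d * coeff n (Φ ^ d) := by
  rw [coeff_subst' (HasSubst.of_constantCoeff_zero' h0),
    finsum_eq_sum_of_support_subset (s := Finset.range N)]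
  · simp
  · intro d hd
    rw [Finset.coe_range, Set.mem_Iio]
    by_contra hlt
    exact hd (by simp [coeff_pow_of_lt h0 (show n < d by omega)])

/-- If `θ = η + σ θ`, where the constant coefficient of `σ` vanishes, then `θ` is finite as soon
as `η` and `σ` are. -/
theorem IsFin.of_eq_add_mul {η σ : PowerSeries ℝ≥0∞} (hη : IsFin η) (hσ : IsFin σ)
    (h0 : constantCoeff σ = 0) (h : θ = η + σ * θ) : IsFin θ := by
  intro n
  induction n using Nat.strong_induction_on with
  | _ n ih =>
    rw [h, map_add, coeff_mul]
    refine ENNReal.add_ne_top.2 ⟨hη n, ENNReal.sum_ne_top.2 ?_⟩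
    rintro ⟨i, j⟩ hij
    rw [Finset.HasAntidiagonal.mem_antidiagonal] at hij
    simp only at hij ⊢
    rcases Nat.eq_zero_or_pos i with rfl | hi
    · simp [h0]
    · exact ENNReal.mul_ne_top (hσ i) (ih j (by omega))

end PowerSeries

/-! ### Closed forms as real power series -/

namespace PlaneTree

open PowerSeries

variable {p : ℕ → ℝ}

theorem constantCoeff_leafGF : constantCoeff (leafGF p) = 0 := by
  rw [← coeff_zero_eq_constantCoeff_apply, leafGF, coeff_gf]
  simp [(card_leaves_pos _).ne']

/-- The generating function of the plane trees, with real coefficients. -/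
noncomputable def leafSeries (p : ℕ → ℝ) : PowerSeries ℝ := realPart (leafGF p)

theorem constantCoeff_leafSeries : constantCoeff (leafSeries p) = 0 := by
  rw [← coeff_zero_eq_constantCoeff_apply, leafSeries, coeff_realPart,
    coeff_zero_eq_constantCoeff_apply, constantCoeff_leafGF, ENNReal.toReal_zero]

theorem isLeafSeries_leafSeries (hp : ∀ j, 0 ≤ p j) (hF : IsFin (leafGF p)) :
    IsLeafSeries p (leafSeries p) := by
  refine ⟨constantCoeff_leafSeries, ?_⟩
  ext n
  rw [map_add, coeff_subst_mk constantCoeff_leafSeries n.lt_succ_self]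
  have hfin (d : ℕ) : coeff n (if d = 0 then X else leafGF p ^ d) ≠ ⊤ := by
    split_ifs
    · exact isFin_X n
    · exact hF.pow d n
  have h : coeff n (leafSeries p) =
      ∑ d ∈ Finset.range (n + 1), p d * coeff n (if d = 0 then X else leafSeries p ^ d) := by
    rw [leafSeries, coeff_realPart, coeff_leafGF hp, tsum_eq_sum (s := Finset.range (n + 1)),
      ENNReal.toReal_sum fun d _ => ENNReal.mul_ne_top ENNReal.ofReal_ne_top (hfin d)]
    · refine Finset.sum_congr rfl fun d _ => ?_
      rw [ENNReal.toReal_mul, ENNReal.toReal_ofReal (hp d), ← coeff_realPart]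
      split_ifs
      · rw [realPart_X]
      · rw [realPart_pow hF]
    · intro d hd
      rw [Finset.mem_range] at hd
      rw [if_neg (by omega), coeff_pow_of_lt constantCoeff_leafGF (by omega), mul_zero]
  rw [h, Finset.sum_range_succ', Finset.sum_range_succ']
  -- The two sums differ only at `d = 0`, where the trees give `p 0 * X` and the substitution gives
  -- `p 0`; the term `p 0 * (X - 1)` makes up for it.
  simp only [Nat.add_eq_zero_iff, one_ne_zero, and_false, if_false, if_true, pow_zero,
    coeff_C_mul, map_sub]
  ring

/-- Only a family of size one has no side branches, and `p 1 = 0`; the term `m = 0` vanishes through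
its factor `m`. Hence the equation for drawings can be solved and `1 - Φ₁` is invertible. -/
theorem constantCoeff_sideGF (h1 : p 1 = 0) : constantCoeff (sideGF p) = 0 := by
  rw [← coeff_zero_eq_constantCoeff_apply, sideGF, coeff_mk]
  refine ENNReal.tsum_eq_zero.2 fun m => ?_
  rcases m with _ | _ | m
  · simp
  · simp [h1]
  · rw [coeff_pow_of_lt constantCoeff_leafGF (by omega)]
    simp

theorem coeff_sideGF (n : ℕ) : coeff n (sideGF p) = ∑ i ∈ Finset.range (n + 1),
    ENNReal.ofReal (p (i + 1)) * ((i + 1 : ℕ) * coeff n (leafGF p ^ i)) := by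
  rw [sideGF, coeff_mk, tsum_eq_sum (s := Finset.range (n + 2)), Finset.sum_range_succ']
  · simp
  · intro d hd
    rw [Finset.mem_range] at hd
    rw [coeff_pow_of_lt constantCoeff_leafGF (by omega), mul_zero, mul_zero]

theorem isFin_sideGF (hF : IsFin (leafGF p)) : IsFin (sideGF p) := fun n => by
  rw [coeff_sideGF]
  exact ENNReal.sum_ne_top.2 fun d _ => ENNReal.mul_ne_top ENNReal.ofReal_ne_top
    (ENNReal.mul_ne_top (ENNReal.natCast_ne_top _) (hF.pow _ n))

theorem realPart_sideGF (hp : ∀ j, 0 ≤ p j) (h1 : p 1 = 0) (hF : IsFin (leafGF p)) :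
    realPart (sideGF p) = leafSeriesOne p (leafSeries p) := by
  ext n
  rw [leafSeriesOne, coeff_subst_mk constantCoeff_leafSeries n.lt_succ_self, coeff_realPart,
    coeff_sideGF, ENNReal.toReal_sum fun d _ => ENNReal.mul_ne_top ENNReal.ofReal_ne_top
    (ENNReal.mul_ne_top (ENNReal.natCast_ne_top _) (hF.pow _ n))]
  refine Finset.sum_congr rfl fun i _ => ?_
  rw [ENNReal.toReal_mul, ENNReal.toReal_mul, ENNReal.toReal_ofReal (hp _), ← coeff_realPart,
    realPart_pow hF, leafSeries]
  split_ifs with h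
  · rw [ENNReal.toReal_natCast]
    push_cast
    ring
  · obtain rfl : i = 0 := by omega
    simp [h1]

theorem constantCoeff_leafSeriesOne (hp : ∀ j, 0 ≤ p j) (h1 : p 1 = 0) (hF : IsFin (leafGF p)) :
    constantCoeff (leafSeriesOne p (leafSeries p)) = 0 := by
  rw [← realPart_sideGF hp h1 hF, ← coeff_zero_eq_constantCoeff_apply, coeff_realPart,
    coeff_zero_eq_constantCoeff_apply, constantCoeff_sideGF h1, ENNReal.toReal_zero]

theorem one_sub_mul_inv (hp : ∀ j, 0 ≤ p j) (h1 : p 1 = 0) (hF : IsFin (leafGF p)) :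
    (1 - leafSeriesOne p (leafSeries p)) * (1 - leafSeriesOne p (leafSeries p))⁻¹ = 1 :=
  PowerSeries.mul_inv_cancel _ (by simp [constantCoeff_leafSeriesOne hp h1 hF])

theorem isFin_rootGF {d : ℕ} {θ : Fin d → PowerSeries ℝ≥0∞} (hF : ∀ i : Fin d, IsFin (θ i)) :
    IsFin (C (ENNReal.ofReal (p d)) * (if d = 0 then X else ∏ i, θ i)) := by
  refine (isFin_C ENNReal.ofReal_ne_top).mul ?_
  split_ifs
  · exact isFin_X
  · exact (isFin_prod fun i _ => hF i).1

theorem isFin_embGF (hp : ∀ j, 0 ≤ p j) (h1 : p 1 = 0) (hF : IsFin (leafGF p)) (τ : PlaneTree) :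
    IsFin (embGF p τ) := by
  induction τ using node_induction with
  | h d τs ih =>
    exact (isFin_rootGF ih).of_eq_add_mul (isFin_sideGF hF) (constantCoeff_sideGF h1)
      (embGF_node hp)

/-- By induction on `τ`: solving the equation at the root contributes one factor `p d` and one
factor (1 - Φ₁)^{-1} per vertex, and one factor `X` per leaf. -/
theorem realPart_embGF (hp : ∀ j, 0 ≤ p j) (h1 : p 1 = 0) (hF : IsFin (leafGF p))
    (τ : PlaneTree) :
    realPart (embGF p τ) = C (τ.weight p) * X ^ τ.leaves.card *
      (1 - leafSeriesOne p (leafSeries p))⁻¹ ^ τ.verts.card := by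
  induction τ using node_induction with
  | h d τs ih =>
    have hfin := isFin_embGF hp h1 hF
    have h := congrArg realPart (embGF_node (τs := τs) hp)
    rw [realPart_add (isFin_rootGF fun i => hfin (τs i)) ((isFin_sideGF hF).mul (hfin _)),
      realPart_mul (isFin_sideGF hF) (hfin _), realPart_sideGF hp h1 hF,
      realPart_mul (isFin_C ENNReal.ofReal_ne_top), realPart_C, ENNReal.toReal_ofReal (hp d)] at h
    swap
    · split_ifs
      · exact isFin_X
      · exact (isFin_prod fun i _ => hfin _).1
    have h' : realPart (if d = 0 then X else ∏ i, embGF p (τs i)) =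
        C (∏ i, (τs i).weight p) * X ^ (node d τs).leaves.card *
          (1 - leafSeriesOne p (leafSeries p))⁻¹ ^ (∑ i, (τs i).verts.card) := by
      rw [card_leaves_node]
      split_ifs with hd
      · subst hd
        simp [realPart_X]
      · rw [(isFin_prod fun i _ => hfin _).2, zero_add]
        simp_rw [ih, Finset.prod_mul_distrib, Finset.prod_pow_eq_pow_sum, map_prod]
    rw [h'] at h
    rw [card_verts_node, weight_node, pow_add, pow_one, map_mul]
    have hinv := one_sub_mul_inv hp h1 hF
    set u := (1 - leafSeriesOne p (leafSeries p))⁻¹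
    linear_combination u * h - realPart (embGF p (node d τs)) * hinv

/-- The chain rule turns the functional equation into Φ' = Φ₁ Φ' + p_0, because `p 1 = 0` makes
P'(Φ) equal to Φ₁. -/
theorem derivative_leafSeries (hp : ∀ j, 0 ≤ p j) (h1 : p 1 = 0) (hF : IsFin (leafGF p)) :
    derivative ℝ (leafSeries p) =
      C (p 0) * (1 - leafSeriesOne p (leafSeries p))⁻¹ := by
  have h := congrArg (derivative ℝ) (isLeafSeries_leafSeries hp hF).2
  have hd : derivative ℝ (PowerSeries.mk p) =
      PowerSeries.mk fun i => if 1 ≤ i then ((i : ℝ) + 1) * p (i + 1) else 0 := by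
    ext i
    rw [coeff_derivative, coeff_mk, coeff_mk]
    split_ifs with hi
    · ring
    · obtain rfl : i = 0 := by omega
      simp [h1]
  rw [map_add, derivative_subst (HasSubst.of_constantCoeff_zero' constantCoeff_leafSeries), hd,
    ← leafSeriesOne, Derivation.leibniz, map_sub, derivative_C, derivative_X] at h
  simp only [smul_eq_mul, sub_zero, mul_one, mul_zero, add_zero,
    Derivation.map_one_eq_zero] at h
  have hinv := one_sub_mul_inv hp h1 hF
  set u := (1 - leafSeriesOne p (leafSeries p))⁻¹
  linear_combination u * h - derivative ℝ (leafSeries p) * hinv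

theorem coeff_embGF (hp : ∀ j, 0 ≤ p j) (h0 : 0 < p 0) (h1 : p 1 = 0) (hF : IsFin (leafGF p))
    (τ : PlaneTree) {n : ℕ} (hn : τ.leaves.card ≤ n) :
    (coeff n (embGF p τ)).toReal = τ.weight p / p 0 * coeff (n - τ.leaves.card)
      ((1 - leafSeriesOne p (leafSeries p))⁻¹ ^ τ.numEdges * derivative ℝ (leafSeries p)) := by
  rw [← coeff_realPart, realPart_embGF hp h1 hF, derivative_leafSeries hp h1 hF,
    mul_left_comm _ (C (p 0)), ← pow_succ, ← card_verts_eq, mul_assoc, coeff_C_mul,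
    coeff_X_pow_mul', if_pos hn, coeff_C_mul]
  field_simp

end PlaneTree

/-! ### The law of the terminal tree -/

open PlaneTree PowerSeries

/-- Only the family sizes at the finitely many vertices of `t` matter, so the event is a finite
intersection of independent ones, with probability the weight of `t`. -/
theorem isTerminalTree_iff {c : List ℕ → ℕ} {t : PlaneTree} :
    IsTerminalTree c t ↔ ∀ u ∈ t.verts, c u = t.outDeg u := by
  have hsnoc (u : List ℕ) (i : ℕ) : u ++ [i] ∈ genealogy c ↔ u ∈ genealogy c ∧ i < c u := by
    constructor
    · exact fun h => ⟨fun v j hv => h v j (hv.trans (List.prefix_append _ _)),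
        h u i List.prefix_rfl⟩
    · rintro ⟨h, hi⟩ v j hv
      rcases List.prefix_concat_iff.1 hv with he | hv
      · obtain ⟨rfl, hj⟩ := List.append_inj' he rfl
        obtain rfl : j = i := by simpa using hj
        exact hi
      · exact h v j hv
  constructor
  · intro h u hu
    refine (outDeg_eq_of_forall fun i => ?_).symm
    have hm (v : List ℕ) : v ∈ t.verts ↔ v ∈ genealogy c := Set.ext_iff.1 h v
    rw [hm, hsnoc, ← hm]
    exact and_iff_right hu
  · intro h
    refine Set.ext fun u => ?_
    rw [Finset.mem_coe]
    induction u using List.reverseRecOn with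
    | nil => simp [t.root_mem, genealogy]
    | append_singleton u i ih =>
      rw [hsnoc, ← ih]
      constructor
      · intro hi
        have hu := t.parent_mem _ _ hi
        exact ⟨hu, by rw [h u hu]; exact snoc_mem_iff.1 hi⟩
      · rintro ⟨hu, hi⟩
        rw [h u hu] at hi
        exact snoc_mem_iff.2 hi

theorem IsTerminalTree.unique {c : List ℕ → ℕ} {s t : PlaneTree} (hs : IsTerminalTree c s)
    (ht : IsTerminalTree c t) : s = t :=
  PlaneTree.ext (Finset.coe_injective (hs.trans ht.symm))

theorem setOf_isTerminalTree {Ω : Type*} (ξ : List ℕ → Ω → ℕ) (t : PlaneTree) : {ω | IsTerminalTree (fun u => ξ u ω) t} =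
    ⋂ u ∈ t.verts, ξ u ⁻¹' {t.outDeg u} := by
  ext ω
  simp [isTerminalTree_iff]

theorem IsGaltonWatson.measurableSet_terminal {Ω : Type*} [MeasurableSpace Ω] {μ : Measure Ω}
    {p : ℕ → ℝ} {ξ : List ℕ → Ω → ℕ} (hξ : IsGaltonWatson μ p ξ) (t : PlaneTree) :
    MeasurableSet {ω | IsTerminalTree (fun u => ξ u ω) t} := by
  rw [setOf_isTerminalTree]
  exact Finset.measurableSet_biInter _ fun u _ => hξ.measurable u (measurableSet_singleton _)

theorem IsGaltonWatson.measurableSet_leafEvent {Ω : Type*} [MeasurableSpace Ω] {μ : Measure Ω}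
    {p : ℕ → ℝ} {ξ : List ℕ → Ω → ℕ} (hξ : IsGaltonWatson μ p ξ) (n : ℕ) :
    MeasurableSet (leafEvent ξ n) := by
  have h : leafEvent ξ n =
      ⋃ t : {t : PlaneTree // t.leaves.card = n},
        {ω | IsTerminalTree (fun u => ξ u ω) t.1} := by
    ext ω
    simp [leafEvent, and_comm]
  rw [h]
  exact MeasurableSet.iUnion fun t => hξ.measurableSet_terminal t.1

namespace IsGaltonWatson

variable {Ω : Type*} [MeasurableSpace Ω] {μ : Measure Ω} [IsProbabilityMeasure μ] {p : ℕ → ℝ}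
  {ξ : List ℕ → Ω → ℕ}

theorem measure_terminal (hξ : IsGaltonWatson μ p ξ) (hp : ∀ j, 0 ≤ p j) (t : PlaneTree) :
    μ {ω | IsTerminalTree (fun u => ξ u ω) t} = t.eweight p := by
  rw [setOf_isTerminalTree, hξ.indep.measure_inter_preimage_eq_mul t.verts
    (sets := fun u => {t.outDeg u}) fun u _ => measurableSet_singleton _, eweight, weight,
    ENNReal.ofReal_prod_of_nonneg fun _ _ => hp _]
  refine Finset.prod_congr rfl fun u _ => ?_
  rw [← hξ.law u, ofReal_measureReal]
  rfl

/-- The probability that the terminal tree exists and belongs to a given set. -/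
theorem measure_exists_terminal (hξ : IsGaltonWatson μ p ξ) (hp : ∀ j, 0 ≤ p j)
    (s : Set PlaneTree) [DecidablePred (· ∈ s)] :
    μ {ω | ∃ t, IsTerminalTree (fun u => ξ u ω) t ∧ t ∈ s} =
      ∑' t, if t ∈ s then t.eweight p else 0 := by
  have h : {ω | ∃ t, IsTerminalTree (fun u => ξ u ω) t ∧ t ∈ s} =
      ⋃ t, {ω | IsTerminalTree (fun u => ξ u ω) t ∧ t ∈ s} := by
    ext ω
    simp
  rw [h, measure_iUnion]
  · refine tsum_congr fun t => ?_
    split_ifs with ht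
    · simp [ht, hξ.measure_terminal hp]
    · simp [ht]
  · intro t t' hne
    rw [Function.onFun, Set.disjoint_left]
    exact fun ω h1 h2 => hne (h1.1.unique h2.1)
  · intro t
    by_cases ht : t ∈ s
    · simpa [ht] using hξ.measurableSet_terminal t
    · simp [ht]

theorem tsum_eweight_eq (hξ : IsGaltonWatson μ p ξ) (hp : ∀ j, 0 ≤ p j) :
    ∑' t : PlaneTree, t.eweight p = μ {ω | ∃ t, IsTerminalTree (fun u => ξ u ω) t} := by
  classical
  simpa using (hξ.measure_exists_terminal hp Set.univ).symm

theorem tsum_eweight_le_one (hξ : IsGaltonWatson μ p ξ) (hp : ∀ j, 0 ≤ p j) :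
    ∑' t : PlaneTree, t.eweight p ≤ 1 := by
  rw [hξ.tsum_eweight_eq hp]
  exact prob_le_one

theorem measure_leafEvent (hξ : IsGaltonWatson μ p ξ) (hp : ∀ j, 0 ≤ p j) (n : ℕ) :
    μ (leafEvent ξ n) = coeff n (leafGF p) := by
  rw [leafGF, coeff_gf]
  exact hξ.measure_exists_terminal hp {t | t.leaves.card = n}

theorem isFin_leafGF (hξ : IsGaltonWatson μ p ξ) (hp : ∀ j, 0 ≤ p j) : (leafGF p).IsFin :=
  fun n => by
    rw [← hξ.measure_leafEvent hp]
    exact measure_ne_top _ _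

end IsGaltonWatson

/-! ### Extinction, and uniqueness of the leaf series -/

namespace PlaneTree

variable {p : ℕ → ℝ}

theorem tsum_eweight_eq_tsum (hp : ∀ j, 0 ≤ p j) : ∑' t : PlaneTree, t.eweight p =
    ∑' d, ENNReal.ofReal (p d) * (∑' t : PlaneTree, t.eweight p) ^ d := by
  conv_lhs => rw [← nodeEquiv.tsum_eq, ENNReal.tsum_sigma']
  refine tsum_congr fun d => ?_
  simp_rw [nodeEquiv_mk, eweight_node hp]
  rw [ENNReal.tsum_mul_left]
  congr 1
  -- If all sizes are zero, the constant coefficient is the total weight, and `gf_pi` becomes the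
  -- product formula for sums over tuples.
  have hc {α : Type} (w : α → ℝ≥0∞) : constantCoeff (gf (fun _ => 0) w) = ∑' a, w a := by
    rw [← coeff_zero_eq_constantCoeff_apply, coeff_gf]
    simp
  simpa [hc] using congrArg constantCoeff
    (gf_pi (d := d) (fun _ _ => 0) fun _ t => eweight p t)

/-- A critical process with `p 1 = 0` dies out. -/
theorem tsum_eweight_eq_one (hp : ∀ j, 0 ≤ p j) (hsum : HasSum p 1) (h1 : p 1 = 0)
    (hmean : HasSum (fun j : ℕ => (j : ℝ) * p j) 1)
    (hle : ∑' t : PlaneTree, t.eweight p ≤ 1) : ∑' t : PlaneTree, t.eweight p = 1 := by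
  have hfix := tsum_eweight_eq_tsum hp
  set q := ∑' t : PlaneTree, t.eweight p
  have hq : q ≠ ⊤ := ne_top_of_le_ne_top ENNReal.one_ne_top hle
  have hr1 : q.toReal ≤ 1 := by
    simpa using ENNReal.toReal_mono ENNReal.one_ne_top hle
  have hr0 : 0 ≤ q.toReal := ENNReal.toReal_nonneg
  have hterm (d : ℕ) : (ENNReal.ofReal (p d) * q ^ d).toReal = p d * q.toReal ^ d := by
    rw [ENNReal.toReal_mul, ENNReal.toReal_pow, ENNReal.toReal_ofReal (hp d)]
  have hr : HasSum (fun d => p d * q.toReal ^ d) q.toReal := by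
    have h := ENNReal.hasSum_toReal (hfix ▸ hq)
    rw [← ENNReal.tsum_toReal_eq (ENNReal.ne_top_of_tsum_ne_top (hfix ▸ hq)), ← hfix] at h
    simpa only [hterm] using h
  by_contra hne
  have hlt : q.toReal < 1 := lt_of_le_of_ne hr1 fun h => hne
    ((ENNReal.toReal_eq_toReal_iff' hq ENNReal.one_ne_top).1 (by simpa using h))
  obtain ⟨i, hi⟩ : ∃ i : ℕ, (i : ℝ) * p i ≠ 0 := by
    by_contra! h
    simp_rw [h] at hmean
    exact zero_ne_one (hasSum_zero.unique hmean)
  have hi2 : 2 ≤ i := by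
    rcases i with _ | _ | i
    · simp at hi
    · simp [h1] at hi
    · omega
  have hpi : 0 < p i := lt_of_le_of_ne (hp i) fun h => hi (by rw [← h, mul_zero])
  have hbern (j : ℕ) : 1 - q.toReal ^ j ≤ j * (1 - q.toReal) := by
    have := one_add_mul_le_pow (show (-2 : ℝ) ≤ q.toReal - 1 by linarith) j
    rw [add_sub_cancel] at this
    linarith
  -- Write 1 - q^(k+1) = (1 - q) + q (1 - q^k), bound the last factor by k (1 - q), and use q < 1
  -- and k ≥ 1. Weighted by `p` and summed, the inequalities would give 1 - q < 1 - q.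
  have hstrict : 1 - q.toReal ^ i < i * (1 - q.toReal) := by
    obtain ⟨k, rfl⟩ : ∃ k, i = k + 1 := ⟨i - 1, by omega⟩
    have h := hbern k
    have hk : (1 : ℝ) ≤ k := by exact_mod_cast (by omega : 1 ≤ k)
    have h' := mul_le_mul_of_nonneg_left h hr0
    have h'' : q.toReal * (k * (1 - q.toReal)) < k * (1 - q.toReal) :=
      mul_lt_of_lt_one_left (mul_pos (by linarith) (by linarith)) hlt
    push_cast
    rw [pow_succ]
    linarith
  have := hasSum_lt (f := fun j => p j - p j * q.toReal ^ j)
    (g := fun j => (j : ℝ) * p j * (1 - q.toReal)) (i := i)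
    (fun j => by
      have := mul_le_mul_of_nonneg_left (hbern j) (hp j)
      simp only
      linarith)
    (by
      have := mul_lt_mul_of_pos_left hstrict hpi
      linarith)
    (hsum.sub hr) (hmean.mul_right _)
  linarith

end PlaneTree

/-- The functional equation determines the coefficients of a leaf series recursively. -/
theorem IsLeafSeries.unique {p : ℕ → ℝ} (h1 : p 1 = 0) {Φ Ψ : PowerSeries ℝ}
    (hΦ : IsLeafSeries p Φ) (hΨ : IsLeafSeries p Ψ) : Ψ = Φ := by
  ext n
  induction n using Nat.strong_induction_on with
  | _ n ih =>
    rw [hΦ.2, hΨ.2, map_add, map_add, coeff_subst_mk hΦ.1 n.lt_succ_self,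
      coeff_subst_mk hΨ.1 n.lt_succ_self]
    congr 1
    refine Finset.sum_congr rfl fun d _ => ?_
    rcases d with _ | _ | d
    · simp
    -- The linear term is the only one that would involve the `n`-th coefficient itself.
    · simp [h1]
    · congr 1
      -- In Ψ^(d+2) - Φ^(d+2) the factor Ψ - Φ is divisible by X^n by induction, and every term of
      -- the cofactor contains Φ or Ψ, which supplies one more X.
      have hdvd : (X : PowerSeries ℝ) ^ (n + 1) ∣ Ψ ^ (d + 2) - Φ ^ (d + 2) := by
        rw [← (Commute.all Ψ Φ).mul_geom_sum₂ (d + 2), pow_succ]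
        refine mul_dvd_mul (X_pow_dvd_iff.2 fun m hm => by rw [map_sub, ih m hm, sub_self])
          (Finset.dvd_sum fun i hi => ?_)
        rw [Finset.mem_range] at hi
        have hX {Θ : PowerSeries ℝ} (h : constantCoeff Θ = 0) {k : ℕ} (hk : k ≠ 0) :
            X ∣ Θ ^ k := dvd_pow (X_dvd_iff.2 h) hk
        by_cases hi0 : i = 0
        · exact (hX hΦ.1 (by omega)).mul_left _
        · exact (hX hΨ.1 hi0).mul_right _
      have := X_pow_dvd_iff.1 hdvd n n.lt_succ_self
      rwa [map_sub, sub_eq_zero] at this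

/-! ### Convergence in the closed unit disc -/

namespace PowerSeries

/-- Values of a series with nonnegative coefficients of finite sum multiply in the unit disc. -/
theorem hasSum_pow {Φ : PowerSeries ℝ} (hnn : ∀ n, 0 ≤ coeff n Φ) {z w : ℂ} (hz : ‖z‖ ≤ 1)
    (hs : Summable fun n => coeff n Φ) (hw : HasSum (fun n => ((coeff n Φ : ℝ) : ℂ) * z ^ n) w)
    (d : ℕ) : (∀ n, 0 ≤ coeff n (Φ ^ d)) ∧
      HasSum (fun n => coeff n (Φ ^ d)) ((∑' n, coeff n Φ) ^ d) ∧
      HasSum (fun n => ((coeff n (Φ ^ d) : ℝ) : ℂ) * z ^ n) (w ^ d) := by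
  have hnorm {Θ : PowerSeries ℝ} (h0 : ∀ n, 0 ≤ coeff n Θ) (h : Summable fun n => coeff n Θ) :
      Summable fun n => ‖((coeff n Θ : ℝ) : ℂ) * z ^ n‖ := by
    refine Summable.of_nonneg_of_le (fun _ => norm_nonneg _) (fun n => ?_) h
    rw [norm_mul, norm_pow, Complex.norm_real, Real.norm_of_nonneg (h0 n)]
    exact mul_le_of_le_one_right (h0 n) (pow_le_one₀ (norm_nonneg _) hz)
  induction d with
  | zero =>
    refine ⟨fun n => ?_, ?_, ?_⟩
    · rw [pow_zero, coeff_one]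
      split_ifs <;> simp
    · simpa [coeff_one] using hasSum_ite_eq (0 : ℕ) (1 : ℝ)
    · rw [pow_zero]
      refine (hasSum_ite_eq (0 : ℕ) (1 : ℂ)).congr_fun fun n => ?_
      rw [coeff_one]
      split_ifs with h <;> simp [h]
  | succ d ih =>
    obtain ⟨h0, h1, h2⟩ := ih
    have hn1 : Summable fun n => ‖coeff n (Φ ^ d)‖ := h1.summable.norm
    have hn2 : Summable fun n => ‖coeff n Φ‖ := hs.norm
    refine ⟨fun n => ?_, ?_, ?_⟩
    · rw [pow_succ, coeff_mul]
      exact Finset.sum_nonneg fun _ _ => mul_nonneg (h0 _) (hnn _)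
    · have hprod := (summable_norm_sum_mul_antidiagonal_of_summable_norm hn1 hn2).of_norm.hasSum
      rw [← tsum_mul_tsum_eq_tsum_sum_antidiagonal_of_summable_norm hn1 hn2, h1.tsum_eq,
        ← pow_succ] at hprod
      simpa only [pow_succ, coeff_mul] using hprod
    · have hc1 := hnorm h0 h1.summable
      have hc2 := hnorm hnn hs
      have hprod := (summable_norm_sum_mul_antidiagonal_of_summable_norm hc1 hc2).of_norm.hasSum
      rw [← tsum_mul_tsum_eq_tsum_sum_antidiagonal_of_summable_norm hc1 hc2, h2.tsum_eq,
        hw.tsum_eq, ← pow_succ] at hprod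
      refine hprod.congr_fun fun n => ?_
      rw [pow_succ, coeff_mul, Complex.ofReal_sum, Finset.sum_mul]
      refine Finset.sum_congr rfl fun x hx => ?_
      rw [← Finset.HasAntidiagonal.mem_antidiagonal.1 hx, pow_add]
      push_cast
      ring

end PowerSeries

/-- In the closed unit disc, a leaf series with nonnegative coefficients of sum at most one
satisfies the functional equation as an identity of convergent series. -/
theorem IsLeafSeries.hasSum {p : ℕ → ℝ} (hp : ∀ j, 0 ≤ p j) (hsum : HasSum p 1)
    {Φ : PowerSeries ℝ} (hΦ : IsLeafSeries p Φ) (hnn : ∀ n, 0 ≤ coeff n Φ)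
    (hs : Summable fun n => coeff n Φ) (hle : ∑' n, coeff n Φ ≤ 1) {z : ℂ} (hz : ‖z‖ ≤ 1) :
    ∃ w : ℂ, ‖w‖ ≤ 1 ∧ HasSum (fun n : ℕ => ((coeff n Φ : ℝ) : ℂ) * z ^ n) w ∧
      HasSum (fun j : ℕ => (p j : ℂ) * w ^ j) (w - (p 0 : ℂ) * (z - 1)) := by
  have hterm {c : ℝ} (hc : 0 ≤ c) (n : ℕ) : ‖(c : ℂ) * z ^ n‖ ≤ c := by
    rw [norm_mul, norm_pow, Complex.norm_real, Real.norm_of_nonneg hc]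
    exact mul_le_of_le_one_right hc (pow_le_one₀ (norm_nonneg _) hz)
  have hw : HasSum (fun n : ℕ => ((coeff n Φ : ℝ) : ℂ) * z ^ n) _ :=
    (Summable.of_norm_bounded hs fun n => hterm (hnn n) n).hasSum
  set w := ∑' n : ℕ, ((coeff n Φ : ℝ) : ℂ) * z ^ n
  have hw1 : ‖w‖ ≤ 1 := (tsum_of_norm_bounded hs.hasSum fun n => hterm (hnn n) n).trans hle
  clear_value w
  have hpow := hasSum_pow hnn hz hs hw
  refine ⟨w, hw1, hw, ?_⟩
  have hS0 : 0 ≤ ∑' n, coeff n Φ := tsum_nonneg hnn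
  -- The norms are dominated by `p j` times the coefficients of Φ^j, whose row sums `p j` · Φ(1)^j
  -- are at most `p j`.
  have hdouble : Summable fun x : ℕ × ℕ =>
      (p x.1 : ℂ) * (((coeff x.2 (Φ ^ x.1) : ℝ) : ℂ) * z ^ x.2) := by
    refine Summable.of_norm_bounded (g := fun x : ℕ × ℕ => p x.1 * coeff x.2 (Φ ^ x.1)) ?_ ?_
    · have hnn' (j n : ℕ) : 0 ≤ p j * coeff n (Φ ^ j) := mul_nonneg (hp j) ((hpow j).1 n)
      have hrow (j : ℕ) : HasSum (fun n => p j * coeff n (Φ ^ j))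
          (p j * (∑' n, coeff n Φ) ^ j) := (hpow j).2.1.mul_left (p j)
      rw [summable_prod_of_nonneg fun x => hnn' x.1 x.2]
      refine ⟨fun j => (hrow j).summable, ?_⟩
      refine Summable.of_nonneg_of_le (fun j => tsum_nonneg (hnn' j)) (fun j => ?_) hsum.summable
      rw [(hrow j).tsum_eq]
      exact mul_le_of_le_one_right (hp j) (pow_le_one₀ hS0 hle)
    · intro x
      rw [norm_mul, Complex.norm_real, Real.norm_of_nonneg (hp _)]
      exact mul_le_mul_of_nonneg_left (hterm ((hpow _).1 _) _) (hp _)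
  have hrow (j : ℕ) : HasSum (fun n => (p j : ℂ) * (((coeff n (Φ ^ j) : ℝ) : ℂ) * z ^ n))
      ((p j : ℂ) * w ^ j) := (hpow j).2.2.mul_left _
  have hcol (n : ℕ) : HasSum (fun j => (p j : ℂ) * (((coeff n (Φ ^ j) : ℝ) : ℂ) * z ^ n))
      (((coeff n Φ - coeff n (C (p 0) * (X - 1)) : ℝ) : ℂ) * z ^ n) := by
    have hc : coeff n Φ - coeff n (C (p 0) * (X - 1)) =
        ∑ d ∈ Finset.range (n + 1), p d * coeff n (Φ ^ d) := by
      rw [← coeff_subst_mk hΦ.1 n.lt_succ_self, sub_eq_iff_eq_add, ← map_add]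
      exact congrArg _ hΦ.2
    rw [hc, Complex.ofReal_sum, Finset.sum_mul]
    convert hasSum_sum_of_ne_finset_zero (s := Finset.range (n + 1)) fun j hj => ?_ using 1
    · refine Finset.sum_congr rfl fun j _ => ?_
      push_cast
      ring
    · rw [Finset.mem_range] at hj
      rw [coeff_pow_of_lt hΦ.1 (by omega)]
      simp
    · infer_instance
  have hX : HasSum (fun n => ((coeff n (C (p 0) * (X - 1)) : ℝ) : ℂ) * z ^ n)
      ((p 0 : ℂ) * (z - 1)) := by
    convert hasSum_sum_of_ne_finset_zero (s := Finset.range 2) fun n hn => ?_ using 1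
    · simp [Finset.sum_range_succ, coeff_one, coeff_X]
      ring
    · rw [Finset.mem_range] at hn
      simp [coeff_one, coeff_X, show n ≠ 0 by omega, show n ≠ 1 by omega]
    · infer_instance
  have hdiff : HasSum (fun n => ((coeff n Φ - coeff n (C (p 0) * (X - 1)) : ℝ) : ℂ) * z ^ n)
      (w - (p 0 : ℂ) * (z - 1)) :=
    (hw.sub hX).congr_fun fun n => by rw [Complex.ofReal_sub, sub_mul]
  -- Summed by rows the array gives the sum of the `p j * w ^ j`; summed by columns it gives the
  -- series P(Φ) at `z`, known from the formal equation.
  have h1 := hdouble.hasSum.prod_fiberwise hrow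
  have h2 := ((Equiv.prodComm ℕ ℕ).hasSum_iff.2 hdouble.hasSum).prod_fiberwise hcol
  rwa [h2.unique hdiff] at h1

/-- The number of bijections that extend a given injection of a subset. -/
theorem card_equiv_extending {α β : Type*} [Fintype α] [Fintype β]
    (h : Fintype.card α = Fintype.card β) (S : Finset α) {g : S → β} (hg : Function.Injective g) :
    Nat.card {e : α ≃ β // ∀ s : S, e s = g s} = (Fintype.card α - S.card)! := by
  classical
  have e1 : {e : α ≃ β // ∀ s : S, e s = g s} ≃
      (((S : Set α)ᶜ : Set α) ≃ ((Set.range g)ᶜ : Set β)) :=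
    Equiv.Set.compl (s := (S : Set α)) (t := Set.range g) (Equiv.ofInjective g hg)
  have c1 : Fintype.card ((S : Set α)ᶜ : Set α) = Fintype.card α - S.card := by
    rw [Fintype.card_compl_set]
    simp
  have c2 : Fintype.card ((Set.range g)ᶜ : Set β) = Fintype.card α - S.card := by
    rw [Fintype.card_compl_set, Set.card_range_of_injective hg, h]
    simp
  rw [Nat.card_congr e1, Nat.card_eq_fintype_card,
    Fintype.card_equiv (Fintype.equivOfCardEq (c1.trans c2.symm)), c1]

/-! ### Counting the favourable labellings -/

namespace LabelledTree

theorem card_leaves {L : Type*} [Fintype L] (T : LabelledTree L) :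
    T.leaves.card = Fintype.card L := by
  rw [← Set.ncard_coe_finset, ← T.range_pos, ← Set.image_univ,
    Set.ncard_image_of_injective _ T.pos_injective, Set.ncard_univ, Nat.card_eq_fintype_card]

instance {n : ℕ} : Countable (LabelledTree (Fin n)) :=
  Function.Injective.countable (f := fun T => (T.toPlaneTree, T.pos)) fun S T h => by
    obtain ⟨h1, h2⟩ := Prod.mk.inj h
    exact LabelledTree.ext (congrArg verts h1) h2

/-- The labelling of the leaves of a plane tree by means of a bijection. -/
def ofEquiv {L : Type*} {t : PlaneTree} (e : L ≃ t.leaves) : LabelledTree L where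
  toPlaneTree := t
  pos s := (e s).1
  pos_injective := Subtype.val_injective.comp e.injective
  range_pos := by
    rw [Set.range_comp' Subtype.val e, e.range_eq_univ, Set.image_univ, Subtype.range_coe]

variable {n : ℕ} {S : Finset (Fin n)} {τ : LabelledTree S}

/-- A labelling of `t` in which `S` induces `τ` is a drawing of `τ` into `t`, together with a
bijective labelling that extends the one which the drawing imposes. -/
theorem exists_equiv_induces (hτ : ∀ v ∈ τ.verts, v ∉ τ.leaves → 2 ≤ τ.outDeg v)
    (t : PlaneTree) :
    Nonempty ((Σ f : embSet τ.toPlaneTree t, {e : Fin n ≃ t.leaves //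
        ∀ s : S, e s = ⟨f.1 (τ.pos s), f.2.1.map_leaf (τ.pos_mem_leaves s)⟩}) ≃
      {x : {T : LabelledTree (Fin n) // T.Induces S τ} // x.1.toPlaneTree = t}) := by
  refine ⟨Equiv.ofBijective (fun x => ⟨⟨ofEquiv x.2.1, (induces_iff hτ).2
    ⟨x.1.1, x.1.2.1, fun s => (congrArg Subtype.val (x.2.2 s)).symm⟩⟩, rfl⟩) ⟨?_, ?_⟩⟩
  · rintro ⟨f, e, he⟩ ⟨f', e', he'⟩ h
    have hpos : (ofEquiv e).pos = (ofEquiv e').pos :=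
      congrArg (fun x => x.1.1.pos) h
    obtain rfl : e = e' := Equiv.ext fun i => Subtype.ext (congrFun hpos i)
    obtain rfl : f = f' := by
      refine Subtype.ext (funext fun u => ?_)
      by_cases hu : u ∈ τ.verts
      · refine f.2.1.eqOn_of_leaves f'.2.1 hτ (fun l hl => ?_) hu
        obtain ⟨s, rfl⟩ := τ.exists_pos_eq hl
        exact congrArg Subtype.val ((he s).symm.trans (he' s))
      · rw [f.2.2 u hu, f'.2.2 u hu]
    rfl
  · rintro ⟨⟨T, hT⟩, rfl⟩
    obtain ⟨f, hf, hpos⟩ := (induces_iff hτ).1 hT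
    classical
    have hg : IsEmb τ.toPlaneTree T.toPlaneTree fun u => if u ∈ τ.verts then f u else [] := by
      refine ⟨fun u hu => ?_, fun u hu => ?_, fun u i hi => ?_⟩
      · simpa [hu] using hf.mem u hu
      · simpa [hu] using hf.outDeg_eq u hu
      · simpa [hi, τ.parent_mem _ _ hi] using hf.step u i hi
    let e : Fin n ≃ T.leaves := Equiv.ofBijective (fun i => ⟨T.pos i, T.pos_mem_leaves i⟩)
      ⟨fun i j h => T.pos_injective (congrArg Subtype.val h), fun l => by
        obtain ⟨s, hs⟩ := T.exists_pos_eq l.2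
        exact ⟨s, Subtype.ext hs⟩⟩
    exact ⟨⟨⟨_, hg, fun u hu => if_neg hu⟩, e, fun s => Subtype.ext (by
      simp only [τ.pos_mem s, if_true, hpos]
      rfl)⟩, rfl⟩

/-- Each drawing fixes the places of the labels in `S`, and the other labels can be put on the
remaining leaves in (n - a)! ways. -/
theorem card_induces (hτ : ∀ v ∈ τ.verts, v ∉ τ.leaves → 2 ≤ τ.outDeg v) (t : PlaneTree) :
    ENat.card {x : {T : LabelledTree (Fin n) // T.Induces S τ} // x.1.toPlaneTree = t} =
      if t.leaves.card = n then
        ((embCount τ.toPlaneTree t * (n - S.card)! : ℕ) : ℕ∞) else 0 := by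
  obtain ⟨E⟩ := exists_equiv_induces hτ t
  have := Fintype.ofFinite (embSet τ.toPlaneTree t)
  rw [← ENat.card_congr E]
  split_ifs with h
  · rw [ENat.card_eq_coe_natCard, Nat.card_sigma]
    congr 1
    rw [Finset.sum_congr rfl (g := fun _ => (n - S.card)!) fun f _ => ?_]
    · rw [Finset.sum_const, Finset.card_univ, smul_eq_mul, embCount, Nat.card_eq_fintype_card]
    · have := card_equiv_extending (β := t.leaves) (by simp [h]) S
        (g := fun s => ⟨f.1 (τ.pos s), f.2.1.map_leaf (τ.pos_mem_leaves s)⟩) fun s s' hs =>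
          τ.pos_injective (f.2.1.inj (τ.pos_mem s) (τ.pos_mem s') (congrArg Subtype.val hs))
      rwa [Fintype.card_fin] at this
  · rw [ENat.card_eq_zero_iff_empty]
    exact ⟨fun x => h (by simpa using (Fintype.card_congr x.2.1).symm)⟩

end LabelledTree

/-! ### The probability of the induced event -/

namespace IsUniformLabelling

variable {Ω : Type*} [MeasurableSpace Ω] {μ : Measure Ω} [IsProbabilityMeasure μ] {p : ℕ → ℝ}
  {ξ : List ℕ → Ω → ℕ} {n : ℕ} {T : Ω → LabelledTree (Fin n)}

theorem measure_eq (hT : IsUniformLabelling μ ξ n T) (hξ : IsGaltonWatson μ p ξ)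
    (hp : ∀ j, 0 ≤ p j) (τ : LabelledTree (Fin n)) :
    μ {ω | ω ∈ leafEvent ξ n ∧ T ω = τ} = τ.eweight p / n ! := by
  rw [← ofReal_measureReal, hT.uniform, ENNReal.ofReal_div_of_pos (by positivity),
    ofReal_measureReal, hξ.measure_terminal hp, ENNReal.ofReal_natCast]

/-- Split the event by the value of the labelled tree and group the values by their plane tree:
every labelling of `t` has probability `t.eweight p / n !`, and `card_induces` counts the favourable
ones. -/
theorem measure_inducedEvent (hT : IsUniformLabelling μ ξ n T) (hξ : IsGaltonWatson μ p ξ)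
    (hp : ∀ j, 0 ≤ p j) {S : Finset (Fin n)} {τ : LabelledTree S}
    (hτ : ∀ v ∈ τ.verts, v ∉ τ.leaves → 2 ≤ τ.outDeg v) :
    μ (inducedEvent ξ n T S τ) =
      ((n - S.card)! : ℝ≥0∞) / n ! * coeff n (embGF p τ.toPlaneTree) := by
  have h : inducedEvent ξ n T S τ = ⋃ x : {T : LabelledTree (Fin n) // T.Induces S τ},
      {ω | ω ∈ leafEvent ξ n ∧ T ω = x.1} := by
    ext ω
    simp [inducedEvent, and_comm]
  rw [h, measure_iUnion]
  · simp_rw [hT.measure_eq hξ hp]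
    rw [← (Equiv.sigmaFiberEquiv
      fun x : {T : LabelledTree (Fin n) // T.Induces S τ} => x.1.toPlaneTree).tsum_eq,
      ENNReal.tsum_sigma', embGF, coeff_gf, ← ENNReal.tsum_mul_left]
    refine tsum_congr fun t => ?_
    have hc (y : {x : {T : LabelledTree (Fin n) // T.Induces S τ} // x.1.toPlaneTree = t}) :
        y.1.1.eweight p / (n ! : ℝ≥0∞) = t.eweight p / n ! := by rw [y.2]
    simp only [Equiv.sigmaFiberEquiv, Equiv.coe_fn_mk]
    rw [tsum_congr hc, ENNReal.tsum_const, LabelledTree.card_induces hτ]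
    split_ifs
    · push_cast
      rw [div_eq_mul_inv, div_eq_mul_inv]
      ring
    · simp
  · intro x y hxy
    rw [Function.onFun, Set.disjoint_left]
    exact fun ω h1 h2 => hxy (Subtype.ext (h1.2.symm.trans h2.2))
  · exact fun x => hT.measurable x.1

end IsUniformLabelling

theorem lemma3 {Ω : Type*} [MeasurableSpace Ω] (μ : Measure Ω) [IsProbabilityMeasure μ]
    (p : ℕ → ℝ) (hp_nonneg : ∀ j, 0 ≤ p j) (hp_sum : HasSum p 1)
    (hp_zero : 0 < p 0) (hp_one : p 1 = 0) (hp_mean : HasSum (fun j : ℕ => (j : ℝ) * p j) 1)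
    (ξ : List ℕ → Ω → ℕ) (hξ : IsGaltonWatson μ p ξ) :
    -- almost surely the process stops, with a finite terminal tree
    (∀ᵐ ω ∂μ, ∃ t : PlaneTree, IsTerminalTree (fun u => ξ u ω) t) ∧
    ∃ Φ : PowerSeries ℝ,
      -- the functional equation, as an identity of formal power series, determines `Φ`
      IsLeafSeries p Φ ∧ (∀ Ψ : PowerSeries ℝ, IsLeafSeries p Ψ → Ψ = Φ) ∧
      -- and it holds as an identity of convergent series in the closed unit disc
      (∀ z : ℂ, ‖z‖ ≤ 1 → ∃ w : ℂ, ‖w‖ ≤ 1 ∧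
        HasSum (fun n : ℕ => ((PowerSeries.coeff n Φ : ℝ) : ℂ) * z ^ n) w ∧
        HasSum (fun j : ℕ => (p j : ℂ) * w ^ j) (w - (p 0 : ℂ) * (z - 1))) ∧
      -- part (1)
      (∀ n : ℕ, μ.real (leafEvent ξ n) = PowerSeries.coeff n Φ) ∧
      -- part (2)
      (∀ (n : ℕ) (T : Ω → LabelledTree (Fin n)), IsUniformLabelling μ ξ n T →
        ∀ (S : Finset (Fin n)) (τ : LabelledTree S),
          (∀ v ∈ τ.verts, v ∉ τ.leaves → 2 ≤ τ.outDeg v) →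
          (μ (leafEvent ξ n) ≠ 0 →
            (cond μ (leafEvent ξ n)).real (inducedEvent ξ n T S τ) =
              μ.real (inducedEvent ξ n T S τ) / μ.real (leafEvent ξ n)) ∧
          μ.real (inducedEvent ξ n T S τ) =
            τ.weight p * ((n - S.card)! : ℝ) / (p 0 * (n ! : ℝ)) *
              PowerSeries.coeff (n - S.card)
                (((1 - leafSeriesOne p Φ)⁻¹) ^ τ.numEdges * PowerSeries.derivative ℝ Φ)) := by

  have hF := hξ.isFin_leafGF hp_nonneg
  have hΦ := isLeafSeries_leafSeries hp_nonneg hF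
  have hone := tsum_eweight_eq_one hp_nonneg hp_sum hp_one hp_mean
    (hξ.tsum_eweight_le_one hp_nonneg)
  have hextinct : μ {ω | ∃ t, IsTerminalTree (fun u => ξ u ω) t} = 1 := by
    rw [← hξ.tsum_eweight_eq hp_nonneg, hone]
  have hmeas : MeasurableSet {ω | ∃ t, IsTerminalTree (fun u => ξ u ω) t} := by
    rw [Set.ofPred_exists]
    exact MeasurableSet.iUnion fun t => hξ.measurableSet_terminal t
  have hcoeff (n : ℕ) : μ.real (leafEvent ξ n) = coeff n (leafSeries p) := by
    rw [measureReal_def, hξ.measure_leafEvent hp_nonneg, leafSeries, coeff_realPart]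
  have hdisj : Pairwise (Function.onFun Disjoint (leafEvent ξ)) := by
    intro m n hmn
    rw [Function.onFun, Set.disjoint_left]
    rintro ω ⟨t, ht, rfl⟩ ⟨s, hs, rfl⟩
    exact hmn (by rw [ht.unique hs])
  have htotal : ∑' n, μ (leafEvent ξ n) ≤ 1 := by
    rw [← measure_iUnion hdisj hξ.measurableSet_leafEvent]
    exact prob_le_one
  have hsummable : HasSum (fun n => coeff n (leafSeries p)) (∑' n, μ (leafEvent ξ n)).toReal := by
    have h := ENNReal.hasSum_toReal (ne_top_of_le_ne_top ENNReal.one_ne_top htotal)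
    rw [← ENNReal.tsum_toReal_eq fun n => measure_ne_top _ _] at h
    exact h.congr_fun fun n => (hcoeff n).symm
  have hle : ∑' n, coeff n (leafSeries p) ≤ 1 := by
    rw [hsummable.tsum_eq]
    simpa using ENNReal.toReal_mono ENNReal.one_ne_top htotal
  refine ⟨(prob_compl_eq_zero_iff hmeas).2 hextinct, leafSeries p, hΦ,
    fun Ψ hΨ => hΦ.unique hp_one hΨ, fun z hz => ?_, hcoeff, ?_⟩
  · exact hΦ.hasSum hp_nonneg hp_sum (fun n => hcoeff n ▸ measureReal_nonneg) hsummable.summable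
      hle hz
  · intro n T hT S τ hτ
    refine ⟨fun _ => ?_, ?_⟩
    · have hsub : leafEvent ξ n ∩ inducedEvent ξ n T S τ = inducedEvent ξ n T S τ :=
        Set.inter_eq_right.2 fun ω hω => hω.1
      rw [measureReal_def, cond_apply (hξ.measurableSet_leafEvent n), hsub, ENNReal.toReal_mul,
        ENNReal.toReal_inv, mul_comm, ← div_eq_mul_inv]
      rfl
    · have hcard : τ.leaves.card = S.card := by simpa using τ.card_leaves
      have hSn : S.card ≤ n := by simpa using S.card_le_univ
      rw [measureReal_def, hT.measure_inducedEvent hξ hp_nonneg hτ, ENNReal.toReal_mul,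
        ENNReal.toReal_div, ENNReal.toReal_natCast, ENNReal.toReal_natCast,
        coeff_embGF hp_nonneg hp_zero hp_one hF τ.toPlaneTree (hcard ▸ hSn), hcard]
      have : (n ! : ℝ) ≠ 0 := by positivity
      field_simp
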